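/- **Setting.** Let $\mathbb N=\{1,2,3,\dots\}$. Let $s$ be the Fréchet space of sequences $\xi=(\xi_j)_{j\in\mathbb N}$ in $\mathbb C$ with $|\xi|_n=\big(\sum_j|\xi_j|^2j^{2n}\big)^{1/2}<\infty$ for all $n$, topologised by these norms. Let $s'$ be its strong dual, identified with the space of sequences $\eta$ with $|\eta|_n'=\big(\sum_j|\eta_j|^2j^{-2n}\big)^{1/2}<\infty$ for some $n$ through the pairing $\langle\xi,\eta\rangle=\sum_j\xi_j\overline{\eta_j}$. Put $U_n^\circ=\{\eta\in s':|\eta|_n'\le 1\}$. The noncommutative Schwartz space $\mathcal S=L(s',s)$ is the space of continuous linear maps $s'\to s$ with the topology of uniform convergence on bounded sets, the product $xy=x\circ\iota\circ y$, where $\iota:s\hookrightarrow s'$ is the inclusion, and the involution given by $\langle x^*\xi,\eta\rangle=\langle\xi,x\eta\rangle$ for $\xi,\eta\in s'$. For $x\in\mathcal S$ let $\|x\|_n=\sup\{|x\eta|_n:\eta\in U_n^\circ\}$, and for $x_1,\dots,x_m\in\mathcal S$ let $$\|(x_j)\|_k^{rc}=\max\Big\{\Big\|\sum_jx_j^*x_j\Big\|_k^{1/2},\Big\|\sum_jx_jx_j^*\Big\|_k^{1/2}\Big\}.$$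 For a continuous bilinear form $u:\mathcal S\times\mathcal S\to\mathbb C$ let $\|u\|_n^*=\sup\{|u(x,y)|:\|x\|_n\le1,\ \|y\|_n\le 1\}\in[0,\infty]$. Let $K_n$ be the smallest constant $C\in[0,\infty]$ such that $$\Big|\sum_{j=1}^mu(x_j,y_j)\Big|\le C\,\|u\|_n^*\,\|(x_j)\|_{2n+1}^{rc}\,\|(y_j)\|_{2n+1}^{rc}$$ for all such $u$, all $m$ and all $x_j,y_j\in\mathcal S$, and put $K=\sup_{n\in\mathbb N}K_n$. (In $[0,\infty]$ we use $0\cdot\infty=0$.) An *$n$-state* on $\mathcal S$ is an element of the weak-$*$ closed convex hull, in the dual of $\mathcal S$, of the functionals $\phi_\xi(x)=\langle x\xi,\xi\rangle$, $\xi\in U_n^\circ$. A *Fréchet–Hilbert space* $H$ is a complete Hausdorff locally convex space over $\mathbb C$ whose topology is given by a sequence of seminorms $\|h\|_k=\langle h,h\rangle_k^{1/2}$, where the $\langle\cdot,\cdot\rangle_k$ are positive semidefinite Hermitian sesquilinear forms. For a continuous linear $T:\mathcal S\to H$ put $\|T\|_{n,k}=\sup\{\|Tx\|_k:\|x\|_n\le1\}\in[0,\infty]$.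 **Theorem ('Little' Grothendieck inequality in $\mathcal S$).** We have $K\le\pi^2/6$. Let $H$ be a Fréchet–Hilbert space and let $u_1,u_2:\mathcal S\to H$ be continuous linear maps. 1. For every seminorm index $k$, all $n\in\mathbb N$, all $m$ and all $x_1,\dots,x_m,y_1,\dots,y_m\in\mathcal S$, $$\Big|\sum_{j=1}^m\langle u_1(x_j),u_2(y_j)\rangle_k\Big|\le K\,\|u_1\|_{n,k}\,\|u_2\|_{n,k}\,\|(x_j)\|_{2n+1}^{rc}\,\|(y_j)\|_{2n+1}^{rc}.$$ 2. For every seminorm index $k$ and every $n\in\mathbb N$ there are $(2n+1)$-states $\phi_1,\phi_2,\psi_1,\psi_2$ on $\mathcal S$ such that for all $x,y\in\mathcal S$ $$|\langle u_1(x),u_2(y)\rangle_k|\le K\,\|u_1\|_{n,k}\,\|u_2\|_{n,k}\,\big(\phi_1(x^*x)+\phi_2(xx^*)\big)^{1/2}\big(\psi_1(y^*y)+\psi_2(yy^*)\big)^{1/2}.$$ -/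

import Mathlib

open scoped ENNReal ComplexConjugate Topology

noncomputable section

namespace NCSchwartz

/-! ### Weighted sequence norms -/

/-- The `ℓ²`-norm of `ξ` with weight `(j ^ r)`, `j = 1, 2, …`, is finite. -/
def WSummable (r : ℤ) (ξ : ℕ+ → ℂ) : Prop :=
  Summable fun j : ℕ+ => ‖ξ j‖ ^ 2 * ((j : ℕ) : ℝ) ^ (2 * r)

/-- `(∑ⱼ |ξⱼ|² j^{2r})^{1/2}`; used only where `WSummable r ξ`. -/
def wNorm (r : ℤ) (ξ : ℕ+ → ℂ) : ℝ :=
  √(∑' j : ℕ+, ‖ξ j‖ ^ 2 * ((j : ℕ) : ℝ) ^ (2 * r))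

theorem pnat_cast_pos (j : ℕ+) : (0 : ℝ) < ((j : ℕ) : ℝ) := by exact_mod_cast j.pos

theorem w_term_eq (r : ℤ) (ξ : ℕ+ → ℂ) (j : ℕ+) :
    ‖ξ j‖ ^ 2 * ((j : ℕ) : ℝ) ^ (2 * r) = (‖ξ j‖ * ((j : ℕ) : ℝ) ^ r) ^ (2 : ℝ) := by
  rw [Real.rpow_two, mul_pow, mul_comm 2 r, zpow_mul]
  norm_cast

theorem w_base_nonneg (r : ℤ) (ξ : ℕ+ → ℂ) (j : ℕ+) :
    0 ≤ ‖ξ j‖ * ((j : ℕ) : ℝ) ^ r :=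
  mul_nonneg (norm_nonneg _) (zpow_nonneg (pnat_cast_pos j).le _)

theorem w_term_nonneg (r : ℤ) (ξ : ℕ+ → ℂ) (j : ℕ+) :
    0 ≤ ‖ξ j‖ ^ 2 * ((j : ℕ) : ℝ) ^ (2 * r) :=
  mul_nonneg (sq_nonneg _) (zpow_nonneg (pnat_cast_pos j).le _)

theorem wNorm_nonneg (r : ℤ) (ξ : ℕ+ → ℂ) : 0 ≤ wNorm r ξ := Real.sqrt_nonneg _

theorem wNorm_sq (r : ℤ) (ξ : ℕ+ → ℂ) :
    wNorm r ξ ^ 2 = ∑' j : ℕ+, ‖ξ j‖ ^ 2 * ((j : ℕ) : ℝ) ^ (2 * r) :=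
  Real.sq_sqrt (tsum_nonneg (w_term_nonneg r ξ))

theorem wSummable_zero (r : ℤ) : WSummable r 0 := by
  simp [WSummable, summable_zero]

theorem wAdd_aux {r : ℤ} {ξ η : ℕ+ → ℂ} (hξ : WSummable r ξ) (hη : WSummable r η) :
    WSummable r (ξ + η) ∧ wNorm r (ξ + η) ≤ wNorm r ξ + wNorm r η := by
  unfold WSummable at *
  unfold wNorm
  simp only [w_term_eq] at *
  obtain ⟨h1, h2⟩ := Real.Lp_add_le_tsum_of_nonneg (p := 2) (by norm_num)
    (w_base_nonneg r ξ) (w_base_nonneg r η) hξ hη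
  have hle : ∀ j : ℕ+, (‖(ξ + η) j‖ * ((j : ℕ) : ℝ) ^ r) ^ (2 : ℝ) ≤
      (‖ξ j‖ * ((j : ℕ) : ℝ) ^ r + ‖η j‖ * ((j : ℕ) : ℝ) ^ r) ^ (2 : ℝ) := by
    intro j
    refine Real.rpow_le_rpow (w_base_nonneg _ _ _) ?_ (by norm_num)
    rw [← add_mul]
    exact mul_le_mul_of_nonneg_right (norm_add_le _ _) (zpow_nonneg (pnat_cast_pos j).le _)
  have hs : Summable fun j : ℕ+ => (‖(ξ + η) j‖ * ((j : ℕ) : ℝ) ^ r) ^ (2 : ℝ) :=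
    Summable.of_nonneg_of_le (fun j => Real.rpow_nonneg (w_base_nonneg _ _ _) _) hle h1
  refine ⟨hs, ?_⟩
  simp only [← Real.sqrt_eq_rpow] at h2
  exact (Real.sqrt_le_sqrt (hs.tsum_le_tsum hle h1)).trans h2

theorem wSmul_term (r : ℤ) (c : ℂ) (ξ : ℕ+ → ℂ) (j : ℕ+) :
    ‖(c • ξ) j‖ ^ 2 * ((j : ℕ) : ℝ) ^ (2 * r) =
      ‖c‖ ^ 2 * (‖ξ j‖ ^ 2 * ((j : ℕ) : ℝ) ^ (2 * r)) := by
  simp only [Pi.smul_apply, norm_smul]; ring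

theorem WSummable.smul {r : ℤ} {ξ : ℕ+ → ℂ} (hξ : WSummable r ξ) (c : ℂ) :
    WSummable r (c • ξ) := by
  unfold WSummable at *
  simp only [wSmul_term]
  exact hξ.mul_left _

theorem wNorm_smul (r : ℤ) (c : ℂ) (ξ : ℕ+ → ℂ) : wNorm r (c • ξ) = ‖c‖ * wNorm r ξ := by
  unfold wNorm
  simp only [wSmul_term, tsum_mul_left]
  rw [Real.sqrt_mul (sq_nonneg _), Real.sqrt_sq (norm_nonneg _)]

theorem WSummable.mono {r t : ℤ} (h : r ≤ t) {ξ : ℕ+ → ℂ} (hξ : WSummable t ξ) :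
    WSummable r ξ := by
  refine Summable.of_nonneg_of_le (w_term_nonneg r ξ) (fun j => ?_) hξ
  refine mul_le_mul_of_nonneg_left ?_ (sq_nonneg _)
  exact zpow_le_zpow_right₀ (by exact_mod_cast j.pos) (by omega)

/-- The Cauchy–Schwarz inequality for the pairing of dual weighted spaces. -/
theorem pairing_aux {r : ℤ} {ξ η : ℕ+ → ℂ} (hξ : WSummable r ξ) (hη : WSummable (-r) η) :
    (Summable fun j => conj (ξ j) * η j) ∧
      ‖∑' j, conj (ξ j) * η j‖ ≤ wNorm r ξ * wNorm (-r) η := by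
  unfold WSummable at *
  unfold wNorm
  simp only [w_term_eq] at *
  obtain ⟨h1, h2⟩ := Real.summable_and_inner_le_Lp_mul_Lq_tsum_of_nonneg
    Real.HolderConjugate.two_two (w_base_nonneg r ξ) (w_base_nonneg (-r) η) hξ hη
  have he : ∀ j : ℕ+, ‖ξ j‖ * ((j : ℕ) : ℝ) ^ r * (‖η j‖ * ((j : ℕ) : ℝ) ^ (-r)) =
      ‖conj (ξ j) * η j‖ := by
    intro j
    have := (pnat_cast_pos j).ne'
    rw [zpow_neg, norm_mul, RCLike.norm_conj]
    field_simp
  simp only [he, ← Real.sqrt_eq_rpow] at h1 h2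
  exact ⟨h1.of_norm, (norm_tsum_le_tsum_norm h1).trans h2⟩

/-! ### The space `s` of rapidly decreasing sequences -/

/-- `s` as a linear subspace of `ℂ^ℕ`. -/
def rapidSubmodule : Submodule ℂ (ℕ+ → ℂ) where
  carrier := {ξ | ∀ n : ℕ, WSummable n ξ}
  zero_mem' := fun _ => wSummable_zero _
  add_mem' := fun ha hb n => (wAdd_aux (ha n) (hb n)).1
  smul_mem' := fun c _ ha n => (ha n).smul c

/-- The space `s` of rapidly decreasing sequences. -/
def RapidSeq : Type := rapidSubmodule

instance : AddCommGroup RapidSeq := inferInstanceAs (AddCommGroup rapidSubmodule)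
instance : Module ℂ RapidSeq := inferInstanceAs (Module ℂ rapidSubmodule)

/-- The underlying sequence of an element of `s`. -/
def RapidSeq.val : RapidSeq →ₗ[ℂ] (ℕ+ → ℂ) := rapidSubmodule.subtype

theorem RapidSeq.summable (ξ : RapidSeq) (n : ℕ) : WSummable n ξ.val := ξ.2 n

/-- The norm `|ξ|ₙ = (∑ⱼ |ξⱼ|² j^{2n})^{1/2}` on `s`. -/
def rapidNorm (n : ℕ) : Seminorm ℂ RapidSeq :=
  Seminorm.of (fun ξ => wNorm n ξ.val)
    (fun ξ η => by rw [map_add]; exact (wAdd_aux (ξ.summable n) (η.summable n)).2)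
    (fun c ξ => by rw [map_smul]; exact wNorm_smul _ _ _)

theorem rapidNorm_apply (n : ℕ) (ξ : RapidSeq) : rapidNorm n ξ = wNorm n ξ.val := rfl

/-- The Fréchet topology of `s`, given by the norms `|·|ₙ`. -/
instance : TopologicalSpace RapidSeq :=
  (SeminormFamily.moduleFilterBasis (𝕜 := ℂ) (fun n : ℕ => rapidNorm n)).topology

theorem rapid_withSeminorms : WithSeminorms (𝕜 := ℂ) (fun n : ℕ => rapidNorm n) := ⟨rfl⟩

instance : IsTopologicalAddGroup RapidSeq := rapid_withSeminorms.topologicalAddGroup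
instance : ContinuousSMul ℂ RapidSeq := rapid_withSeminorms.continuousSMul

/-! ### The space `s'` of slowly increasing sequences -/

/-- `s'` as a linear subspace of `ℂ^ℕ`. -/
def slowSubmodule : Submodule ℂ (ℕ+ → ℂ) where
  carrier := {η | ∃ n : ℕ, WSummable (-n) η}
  zero_mem' := ⟨0, wSummable_zero _⟩
  add_mem' := by
    rintro a b ⟨n, hn⟩ ⟨m, hm⟩
    exact ⟨max n m, (wAdd_aux (hn.mono (by push_cast; omega)) (hm.mono (by push_cast; omega))).1⟩
  smul_mem' := fun c _ ⟨n, hn⟩ => ⟨n, hn.smul c⟩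

/-- The space `s'` of slowly increasing sequences, that is, the topological dual of `s`. -/
def SlowSeq : Type := slowSubmodule

instance : AddCommGroup SlowSeq := inferInstanceAs (AddCommGroup slowSubmodule)
instance : Module ℂ SlowSeq := inferInstanceAs (Module ℂ slowSubmodule)

/-- The underlying sequence of an element of `s'`. -/
def SlowSeq.val : SlowSeq →ₗ[ℂ] (ℕ+ → ℂ) := slowSubmodule.subtype

/-- The duality pairing `⟨ξ, η⟩ = ∑ⱼ ξⱼ conj(ηⱼ)` of `ξ ∈ s` and `η ∈ s'`. -/
def pairing (ξ : RapidSeq) (η : SlowSeq) : ℂ := ∑' j, ξ.val j * conj (η.val j)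

theorem summable_pairing (ξ : RapidSeq) (η : SlowSeq) :
    Summable fun j => conj (ξ.val j) * η.val j := by
  obtain ⟨n, hn⟩ := η.2
  exact (pairing_aux (ξ.summable n) hn).1

theorem conj_pairing (ξ : RapidSeq) (η : SlowSeq) :
    conj (pairing ξ η) = ∑' j, conj (ξ.val j) * η.val j := by
  rw [pairing, Complex.conj_tsum]; simp

theorem norm_pairing_le (ξ : RapidSeq) (η : SlowSeq) {n : ℕ} (hn : WSummable (-n) η.val) :
    ‖pairing ξ η‖ ≤ rapidNorm n ξ * wNorm (-n) η.val := by
  rw [← RCLike.norm_conj, conj_pairing]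
  exact (pairing_aux (ξ.summable n) hn).2

/-- For `η ∈ s'`, the continuous conjugate-linear functional `ξ ↦ conj ⟨ξ, η⟩` on `s`. -/
def toDual (η : SlowSeq) : RapidSeq →SL[starRingEnd ℂ] ℂ where
  toFun ξ := conj (pairing ξ η)
  map_add' a b := by
    simp only [conj_pairing]
    rw [← (summable_pairing a η).tsum_add (summable_pairing b η)]
    simp [add_mul]
  map_smul' c a := by
    simp only [conj_pairing, smul_eq_mul]
    rw [← tsum_mul_left]
    simp [mul_assoc]
  cont := by
    obtain ⟨n, hn⟩ := η.2
    let f : RapidSeq →ₛₗ[starRingEnd ℂ] ℂ :=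
      { toFun := fun ξ => conj (pairing ξ η)
        map_add' := fun a b => by
          simp only [conj_pairing]
          rw [← (summable_pairing a η).tsum_add (summable_pairing b η)]
          simp [add_mul]
        map_smul' := fun c a => by
          simp only [conj_pairing, smul_eq_mul]
          rw [← tsum_mul_left]
          simp [mul_assoc] }
    refine WithSeminorms.continuous_normedSpace_rng (τ₁₂ := starRingEnd ℂ) ℂ rapid_withSeminorms f
      ⟨{n}, ⟨wNorm (-n) η.val, wNorm_nonneg _ _⟩, fun ξ => ?_⟩
    have h := norm_pairing_le ξ η hn
    rw [← RCLike.norm_conj, mul_comm] at h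
    rw [Finset.sup_singleton]
    exact h

theorem toDual_apply (η : SlowSeq) (ξ : RapidSeq) : toDual η ξ = conj (pairing ξ η) := rfl

/-- `toDual` as a linear map from `s'` to the space of continuous conjugate-linear functionals. -/
def toDualₗ : SlowSeq →ₗ[ℂ] (RapidSeq →SL[starRingEnd ℂ] ℂ) where
  toFun := toDual
  map_add' a b := by
    ext ξ
    simp only [toDual_apply, add_apply, conj_pairing]
    rw [← (summable_pairing ξ a).tsum_add (summable_pairing ξ b)]
    simp [mul_add]
  map_smul' c a := by
    ext ξ
    simp only [toDual_apply, smul_apply, conj_pairing, RingHom.id_apply,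
      smul_eq_mul]
    rw [← tsum_mul_left]
    simp [mul_left_comm]

/-- The strong dual topology of `s'`: uniform convergence of `⟨·, η⟩` on the bounded subsets
of `s`. -/
instance : TopologicalSpace SlowSeq := TopologicalSpace.induced toDualₗ inferInstance

instance : IsTopologicalAddGroup SlowSeq := topologicalAddGroup_induced toDualₗ
instance : ContinuousSMul ℂ SlowSeq := continuousSMul_induced toDualₗ

theorem slow_hasBasis : (𝓝 (0 : SlowSeq)).HasBasis
    (fun Bε : Set RapidSeq × ℝ => Bornology.IsVonNBounded ℂ Bε.1 ∧ 0 < Bε.2)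
    (fun Bε => {η | ∀ ξ ∈ Bε.1, ‖pairing ξ η‖ < Bε.2}) := by
  rw [nhds_induced, map_zero]
  convert! (ContinuousLinearMap.hasBasis_nhds_zero_of_basis (σ := starRingEnd ℂ)
    (E := RapidSeq) (F := ℂ) Metric.nhds_basis_ball).comap toDualₗ using 1
  ext Bε η
  simp [toDualₗ, toDual_apply]

theorem rapid_isVonNBounded_iff {B : Set RapidSeq} :
    Bornology.IsVonNBounded ℂ B ↔ ∀ n : ℕ, ∃ C > 0, ∀ ξ ∈ B, rapidNorm n ξ < C :=
  rapid_withSeminorms.isVonNBounded_iff_seminorm_bounded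

/-- `Uₙ° = {η ∈ s' : |η|'ₙ ≤ 1}`, where `|η|'ₙ = (∑ⱼ |ηⱼ|² j^{-2n})^{1/2}`. -/
def polarBall (n : ℕ) : Set SlowSeq := {η | WSummable (-n) η.val ∧ wNorm (-n) η.val ≤ 1}

/-! ### The noncommutative Schwartz space `𝒮 = L(s', s)` -/

/-- The noncommutative Schwartz space: continuous linear operators from `s'` to `s`. Its topology,
supplied by Mathlib, is that of uniform convergence on the bounded subsets of `s'`. -/
abbrev SchwartzOp : Type := SlowSeq →L[ℂ] RapidSeq

/-- A continuous operator from `s'` to `s` is bounded on `Uₙ°`. -/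
theorem image_polarBall_bounded (x : SchwartzOp) (n m : ℕ) :
    ∃ C > 0, ∀ η ∈ polarBall n, rapidNorm m (x η) < C := by
  have hc : Continuous fun η => rapidNorm m (x η) :=
    (rapid_withSeminorms.continuous_seminorm m).comp x.continuous
  have hU : {η : SlowSeq | rapidNorm m (x η) < 1} ∈ 𝓝 (0 : SlowSeq) :=
    hc.continuousAt.eventually_lt continuousAt_const (by simp)
  obtain ⟨⟨B, ε⟩, ⟨hB, hε⟩, hsub⟩ := slow_hasBasis.mem_iff.1 hU
  obtain ⟨C, hC, hBC⟩ := rapid_isVonNBounded_iff.1 hB n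
  refine ⟨C / ε, by positivity, fun η hη => ?_⟩
  have hεC : (0 : ℝ) < ε / C := by positivity
  have key : rapidNorm m (x ((ε / C : ℂ) • η)) < 1 := by
    apply hsub
    intro ξ hξ
    have hs : WSummable (-n) ((ε / C : ℂ) • η).val := by
      show WSummable (-n) (SlowSeq.val _)
      rw [map_smul]; exact hη.1.smul _
    refine (norm_pairing_le ξ _ hs).trans_lt ?_
    have hn : wNorm (-n) (SlowSeq.val ((ε / C : ℂ) • η)) ≤ ε / C := by
      rw [map_smul, wNorm_smul, ← Complex.ofReal_div, Complex.norm_real,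
        Real.norm_of_nonneg hεC.le]
      exact mul_le_of_le_one_right hεC.le hη.2
    calc rapidNorm n ξ * wNorm (-n) (SlowSeq.val ((ε / C : ℂ) • η))
        ≤ rapidNorm n ξ * (ε / C) := mul_le_mul_of_nonneg_left hn (apply_nonneg _ _)
      _ < C * (ε / C) := mul_lt_mul_of_pos_right (hBC ξ hξ) hεC
      _ = ε := by field_simp
  rw [map_smul, map_smul_eq_mul, ← Complex.ofReal_div, Complex.norm_real,
    Real.norm_of_nonneg hεC.le] at key
  rw [lt_div_iff₀ hε]
  rw [div_mul_eq_mul_div, div_lt_one hC] at key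
  linarith

/-- The formal identity map `ι : s → s'`. -/
def iota : RapidSeq →L[ℂ] SlowSeq where
  toFun ξ := ⟨ξ.val, 0, by simpa using ξ.summable 0⟩
  map_add' _ _ := rfl
  map_smul' _ _ := rfl
  cont := by
    let f : RapidSeq →+ SlowSeq :=
      { toFun := fun ξ => ⟨ξ.val, 0, by simpa using ξ.summable 0⟩
        map_zero' := rfl
        map_add' := fun _ _ => rfl }
    refine continuous_of_continuousAt_zero f ?_
    rw [ContinuousAt, map_zero, slow_hasBasis.tendsto_right_iff]
    rintro ⟨B, ε⟩ ⟨hB, hε⟩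
    obtain ⟨C, hC, hBC⟩ := rapid_isVonNBounded_iff.1 hB 0
    have hU : ∀ᶠ ζ : RapidSeq in 𝓝 0, rapidNorm 0 ζ < ε / C :=
      (rapid_withSeminorms.continuous_seminorm 0).continuousAt.eventually_lt continuousAt_const
        (by rw [map_zero]; positivity)
    filter_upwards [hU] with ζ hζ ξ hξ
    have hs : WSummable (-(0 : ℕ)) (f ζ).val := ζ.summable 0
    refine (norm_pairing_le ξ (f ζ) hs).trans_lt ?_
    have he : wNorm (-(0 : ℕ)) (f ζ).val = rapidNorm 0 ζ := by simp [rapidNorm_apply]; rfl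
    rw [he]
    calc rapidNorm 0 ξ * rapidNorm 0 ζ
        ≤ C * rapidNorm 0 ζ := mul_le_mul_of_nonneg_right (hBC ξ hξ).le (apply_nonneg _ _)
      _ < C * (ε / C) := mul_lt_mul_of_pos_left hζ hC
      _ = ε := by field_simp

theorem iota_val (ξ : RapidSeq) : (iota ξ).val = ξ.val := rfl

/-- The product `x y = x ∘ ι ∘ y` of `𝒮`. -/
instance : Mul SchwartzOp := ⟨fun x y => (x.comp iota).comp y⟩

theorem mul_apply' (x y : SchwartzOp) (η : SlowSeq) : (x * y) η = x (iota (y η)) := rfl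

/-- Finitely supported sequences belong to `s'`. -/
def slowOfFinset (F : Finset ℕ+) (c : ℕ+ → ℂ) : SlowSeq :=
  ⟨fun j => if j ∈ F then c j else 0, 0,
    summable_of_ne_finset_zero (s := F) fun j hj => by simp [hj]⟩

theorem slowOfFinset_val (F : Finset ℕ+) (c : ℕ+ → ℂ) (j : ℕ+) :
    (slowOfFinset F c).val j = if j ∈ F then c j else 0 := rfl

/-- The standard basis vectors. -/
def slowBasis (j : ℕ+) : SlowSeq := slowOfFinset {j} 1

theorem slowOfFinset_eq_sum (F : Finset ℕ+) (c : ℕ+ → ℂ) :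
    slowOfFinset F c = ∑ j ∈ F, c j • slowBasis j := by
  have hinj : Function.Injective SlowSeq.val := Subtype.val_injective
  apply hinj
  rw [map_sum]
  ext i
  simp [slowOfFinset_val, slowBasis]

/-- The sequence `j ↦ ⟨ξ, x eⱼ⟩ = ∑ᵢ ξᵢ conj((x eⱼ)ᵢ)`. -/
def adjSeq (x : SchwartzOp) (ξ : SlowSeq) (j : ℕ+) : ℂ := toDual ξ (x (slowBasis j))

theorem adjSeq_finset (x : SchwartzOp) (ξ : SlowSeq) (F : Finset ℕ+) (c : ℕ+ → ℂ) :
    toDual ξ (x (slowOfFinset F c)) = ∑ j ∈ F, conj (c j) * adjSeq x ξ j := by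
  rw [slowOfFinset_eq_sum]
  simp only [map_sum, map_smul, map_smulₛₗ, smul_eq_mul, adjSeq]

theorem adjSeq_bound (x : SchwartzOp) (ξ : SlowSeq) (n : ℕ) {M : ℝ}
    (hM : ∀ η ∈ polarBall n, ‖pairing (x η) ξ‖ ≤ M) :
    WSummable n (adjSeq x ξ) ∧ wNorm n (adjSeq x ξ) ≤ M := by
  have hM0 : 0 ≤ M := by
    refine (norm_nonneg _).trans (hM 0 ⟨?_, ?_⟩)
    · rw [map_zero]; exact wSummable_zero _
    · rw [map_zero]; simp [wNorm]
  have hfin : ∀ F : Finset ℕ+,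
      ∑ j ∈ F, ‖adjSeq x ξ j‖ ^ 2 * ((j : ℕ) : ℝ) ^ (2 * (n : ℤ)) ≤ M ^ 2 := by
    intro F
    set A := ∑ j ∈ F, ‖adjSeq x ξ j‖ ^ 2 * ((j : ℕ) : ℝ) ^ (2 * (n : ℤ)) with hA
    have hA0 : 0 ≤ A := Finset.sum_nonneg fun j _ => w_term_nonneg _ _ _
    rcases hA0.eq_or_lt with h0 | hpos
    · rw [← h0]; positivity
    set c : ℕ+ → ℂ := fun j => adjSeq x ξ j * ((((j : ℕ) : ℝ) ^ (2 * (n : ℤ)) : ℝ) : ℂ) with hc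
    have hsq : (√A) ≠ 0 := (Real.sqrt_pos.2 hpos).ne'
    set η : SlowSeq := ((√A : ℝ) : ℂ)⁻¹ • slowOfFinset F c with hη
    have hterm : ∀ j, ‖(slowOfFinset F c).val j‖ ^ 2 * ((j : ℕ) : ℝ) ^ (2 * (-n : ℤ)) =
        if j ∈ F then ‖adjSeq x ξ j‖ ^ 2 * ((j : ℕ) : ℝ) ^ (2 * (n : ℤ)) else 0 := by
      intro j
      have hj := (pnat_cast_pos j).ne'
      rw [slowOfFinset_val]
      split_ifs with h
      · rw [hc]
        simp only [norm_mul, Complex.norm_real, norm_zpow, Real.norm_natCast]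
        rw [mul_neg, zpow_neg]
        field_simp
      · simp
    have hws : WSummable (-n) (slowOfFinset F c).val :=
      summable_of_ne_finset_zero (s := F) fun j hj => by
        simp [slowOfFinset_val, hj]
    have hwn : wNorm (-n) (slowOfFinset F c).val = √A := by
      unfold wNorm
      simp only [hterm]
      rw [tsum_eq_sum (s := F) (fun j hj => by simp [hj]), hA]
      congr 1
      exact Finset.sum_congr rfl fun j hj => by simp [hj]
    have hmem : η ∈ polarBall n := by
      refine ⟨?_, ?_⟩
      · rw [hη, map_smul]; exact hws.smul _
      · rw [hη, map_smul, wNorm_smul, hwn, norm_inv, Complex.norm_real,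
          Real.norm_of_nonneg (Real.sqrt_nonneg _), inv_mul_cancel₀ hsq]
    have h := hM η hmem
    rw [← RCLike.norm_conj, ← toDual_apply, hη, map_smul, map_smulₛₗ, adjSeq_finset] at h
    have hsum : ∑ j ∈ F, conj (c j) * adjSeq x ξ j = (A : ℂ) := by
      rw [hA, Complex.ofReal_sum]
      refine Finset.sum_congr rfl fun j _ => ?_
      rw [hc]
      simp only [map_mul, Complex.conj_ofReal]
      rw [mul_right_comm, ← Complex.normSq_eq_conj_mul_self, Complex.normSq_eq_norm_sq]
      push_cast
      ring
    rw [hsum] at h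
    simp only [map_inv₀, Complex.conj_ofReal, norm_smul, norm_inv, Complex.norm_real,
      Real.norm_of_nonneg (Real.sqrt_nonneg _), Real.norm_of_nonneg hA0] at h
    have h2 : √A ≤ M := by
      have : (√A)⁻¹ * A = √A := by
        rw [inv_mul_eq_div, Real.div_sqrt]
      rwa [this] at h
    calc A = √A ^ 2 := (Real.sq_sqrt hA0).symm
      _ ≤ M ^ 2 := pow_le_pow_left₀ (Real.sqrt_nonneg _) h2 2
  have hs : WSummable n (adjSeq x ξ) :=
    summable_of_sum_le (w_term_nonneg _ _) hfin
  refine ⟨hs, ?_⟩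
  unfold wNorm
  rw [Real.sqrt_le_left hM0]
  exact Real.tsum_le_of_sum_le (w_term_nonneg _ _) hfin

theorem adjSeq_summable (x : SchwartzOp) (ξ : SlowSeq) (n : ℕ) : WSummable n (adjSeq x ξ) := by
  obtain ⟨m, hm⟩ := ξ.2
  obtain ⟨C, hC, hb⟩ := image_polarBall_bounded x n m
  refine (adjSeq_bound x ξ n (M := C * wNorm (-m) ξ.val) fun η hη => ?_).1
  exact (norm_pairing_le _ _ hm).trans
    (mul_le_mul_of_nonneg_right (hb η hη).le (wNorm_nonneg _ _))

/-- The adjoint `x*` as a linear map. -/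
def adjₗ (x : SchwartzOp) : SlowSeq →ₗ[ℂ] RapidSeq where
  toFun ξ := ⟨adjSeq x ξ, adjSeq_summable x ξ⟩
  map_add' a b := by
    apply Subtype.ext
    funext j
    show toDualₗ (a + b) _ = toDualₗ a _ + toDualₗ b _
    rw [map_add]; rfl
  map_smul' c a := by
    apply Subtype.ext
    funext j
    show toDualₗ (c • a) _ = c • toDualₗ a _
    rw [map_smul]; rfl

theorem adjₗ_val (x : SchwartzOp) (ξ : SlowSeq) : (adjₗ x ξ).val = adjSeq x ξ := rfl

/-- The involution of `𝒮`: `x* ξ = (⟨ξ, x eⱼ⟩)ⱼ`; see `pairing_star` for its characterization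
`⟨x* ξ, η⟩ = ⟨ξ, x η⟩`. -/
instance : Star SchwartzOp where
  star x :=
    { adjₗ x with
      cont := by
        refine continuous_of_continuousAt_zero (adjₗ x) ?_
        rw [ContinuousAt, map_zero]
        rw [rapid_withSeminorms.tendsto_nhds]
        intro n ε hε
        have hB : Bornology.IsVonNBounded ℂ (x '' polarBall n) := by
          rw [rapid_isVonNBounded_iff]
          intro m
          obtain ⟨C, hC, h⟩ := image_polarBall_bounded x n m
          exact ⟨C, hC, by rintro _ ⟨η, hη, rfl⟩; exact h η hη⟩
        filter_upwards [slow_hasBasis.mem_of_mem (i := (x '' polarBall n, ε / 2))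
          ⟨hB, by positivity⟩] with ξ hξ
        rw [sub_zero]
        refine lt_of_le_of_lt (adjSeq_bound x ξ n (M := ε / 2) fun η hη => ?_).2 (by linarith)
        exact (hξ _ ⟨η, hη, rfl⟩).le }

theorem star_apply_val (x : SchwartzOp) (ξ : SlowSeq) : ((star x) ξ).val = adjSeq x ξ := rfl

/-- Finite truncations converge in `s'`. -/
theorem tendsto_slowOfFinset (η : SlowSeq) :
    Filter.Tendsto (fun F : Finset ℕ+ => slowOfFinset F η.val) Filter.atTop (𝓝 η) := by
  rw [← tendsto_sub_nhds_zero_iff, slow_hasBasis.tendsto_right_iff]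
  rintro ⟨B, ε⟩ ⟨hB, hε⟩
  obtain ⟨n, hn⟩ := η.2
  obtain ⟨C, hC, hBC⟩ := rapid_isVonNBounded_iff.1 hB n
  have hs : ∀ F : Finset ℕ+, WSummable (-n) (slowOfFinset F η.val - η).val := by
    intro F
    rw [sub_eq_add_neg, ← neg_one_smul ℂ η, map_add, map_smul]
    refine (wAdd_aux ?_ (hn.smul _)).1
    exact summable_of_ne_finset_zero (s := F) fun j hj => by simp [slowOfFinset_val, hj]
  have hval : ∀ (F : Finset ℕ+) (j : ℕ+),
      ‖(slowOfFinset F η.val - η).val j‖ ^ 2 * ((j : ℕ) : ℝ) ^ (2 * (-n : ℤ)) =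
        Set.indicator {j | j ∉ F}
          (fun j : ℕ+ => ‖η.val j‖ ^ 2 * ((j : ℕ) : ℝ) ^ (2 * (-n : ℤ))) j := by
    intro F j
    rw [map_sub, Pi.sub_apply, slowOfFinset_val]
    by_cases h : j ∈ F <;> simp [h]
  have hnorm : ∀ F : Finset ℕ+, wNorm (-n) (slowOfFinset F η.val - η).val =
      √(∑' j : {j // j ∉ F}, ‖η.val j‖ ^ 2 * (((j : ℕ+) : ℕ) : ℝ) ^ (2 * (-n : ℤ))) := by
    intro F
    unfold wNorm
    simp only [hval]
    rw [← tsum_subtype]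
    rfl
  have hlim : Filter.Tendsto (fun F : Finset ℕ+ => wNorm (-n) (slowOfFinset F η.val - η).val)
      Filter.atTop (𝓝 0) := by
    simp only [hnorm]
    have := (tendsto_tsum_compl_atTop_zero
      (fun j : ℕ+ => ‖η.val j‖ ^ 2 * ((j : ℕ) : ℝ) ^ (2 * (-n : ℤ)))).sqrt
    simpa using this
  filter_upwards [hlim.eventually_lt_const (show (0 : ℝ) < ε / C by positivity)] with F hF ξ hξ
  refine (norm_pairing_le ξ _ (hs F)).trans_lt ?_
  calc rapidNorm n ξ * wNorm (-n) (slowOfFinset F η.val - η).val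
      ≤ C * wNorm (-n) (slowOfFinset F η.val - η).val :=
        mul_le_mul_of_nonneg_right (hBC ξ hξ).le (wNorm_nonneg _ _)
    _ < C * (ε / C) := mul_lt_mul_of_pos_left hF hC
    _ = ε := by field_simp

/-- `⟨x* ξ, η⟩ = ⟨ξ, x η⟩`, where `⟨ξ, ζ⟩ = conj ⟨ζ, ξ⟩` for `ξ ∈ s'`, `ζ ∈ s`. -/
theorem pairing_star (x : SchwartzOp) (ξ η : SlowSeq) :
    pairing (star x ξ) η = conj (pairing (x η) ξ) := by
  have h1 : Filter.Tendsto (fun F : Finset ℕ+ => toDual ξ (x (slowOfFinset F η.val)))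
      Filter.atTop (𝓝 (toDual ξ (x η))) :=
    (((toDual ξ).continuous.comp x.continuous).tendsto η).comp (tendsto_slowOfFinset η)
  simp only [adjSeq_finset] at h1
  have h2 : HasSum (fun j => conj (η.val j) * adjSeq x ξ j) (toDual ξ (x η)) := h1
  rw [← toDual_apply, ← h2.tsum_eq, pairing]
  simp [star_apply_val, mul_comm]

/-- The norm `‖x‖ₙ = sup {|x η|ₙ : η ∈ Uₙ°}` of `𝒮`. -/
def opNorm (n : ℕ) (x : SchwartzOp) : ℝ := ⨆ η : polarBall n, rapidNorm n (x η)

theorem opNorm_bddAbove (n : ℕ) (x : SchwartzOp) :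
    BddAbove (Set.range fun η : polarBall n => rapidNorm n (x η)) := by
  obtain ⟨C, -, h⟩ := image_polarBall_bounded x n n
  exact ⟨C, by rintro _ ⟨η, rfl⟩; exact (h η η.2).le⟩

/-- `‖(x₁, …, xₘ)‖ₖ^{rc} = max {‖∑ⱼ xⱼ* xⱼ‖ₖ^{1/2}, ‖∑ⱼ xⱼ xⱼ*‖ₖ^{1/2}}`. -/
def rcNorm (k : ℕ) {m : ℕ} (x : Fin m → SchwartzOp) : ℝ :=
  max √(opNorm k (∑ j, star (x j) * x j)) √(opNorm k (∑ j, x j * star (x j)))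

/-! ### The constant `K` -/

/-- `‖u‖ₙ* = sup {|u(x, y)| : ‖x‖ₙ ≤ 1, ‖y‖ₙ ≤ 1} ∈ [0, ∞]`. -/
def bilinNorm (n : ℕ) (u : SchwartzOp →ₗ[ℂ] SchwartzOp →ₗ[ℂ] ℂ) : ℝ≥0∞ :=
  ⨆ (x : SchwartzOp) (_ : opNorm n x ≤ 1) (y : SchwartzOp) (_ : opNorm n y ≤ 1), ‖u x y‖ₑ

/-- `Kₙ`: the best constant in Grothendieck's inequality
`|∑ⱼ u(xⱼ, yⱼ)| ≤ Kₙ ‖u‖ₙ* ‖(xⱼ)‖^{rc} ‖(yⱼ)‖^{rc}` in `𝒮`, for all continuous bilinear forms `u`,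
with the row/column norms of index `2n+1`. -/
def grothendieckConst (n : ℕ) : ℝ≥0∞ :=
  sInf {C : ℝ≥0∞ | ∀ u : SchwartzOp →ₗ[ℂ] SchwartzOp →ₗ[ℂ] ℂ,
    (Continuous fun p : SchwartzOp × SchwartzOp => u p.1 p.2) →
    ∀ (m : ℕ) (x y : Fin m → SchwartzOp),
      ‖∑ j, u (x j) (y j)‖ₑ ≤ C * bilinNorm n u *
        ENNReal.ofReal (rcNorm (2 * n + 1) x) * ENNReal.ofReal (rcNorm (2 * n + 1) y)}

/-- `K = sup {Kₙ : n = 1, 2, …}`. -/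
def grothendieckK : ℝ≥0∞ := ⨆ (n : ℕ) (_ : 1 ≤ n), grothendieckConst n

/-! ### States -/

/-- For `ξ ∈ s'`, the functional `φ_ξ(x) = ⟨x ξ, ξ⟩` in the dual of `𝒮`. -/
def vectorFunctional (ξ : SlowSeq) : SchwartzOp →L[ℂ] ℂ where
  toFun x := pairing (x ξ) ξ
  map_add' x y := by
    have h := (toDual ξ).map_add (x ξ) (y ξ)
    simp only [toDual_apply, ← map_add] at h
    exact (starRingEnd ℂ).injective h
  map_smul' c x := by
    have h := (toDual ξ).map_smulₛₗ c (x ξ)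
    simp only [toDual_apply, smul_eq_mul, ← map_mul] at h
    exact (starRingEnd ℂ).injective h
  cont := by
    have h : Continuous fun x : SchwartzOp => toDual ξ (x ξ) :=
      (toDual ξ).continuous.comp (continuous_eval_const ξ)
    have h2 := Complex.continuous_conj.comp h
    refine h2.congr fun x => ?_
    simp [toDual_apply]

/-- The set of `n`-states: the weak-* closed convex hull of `{φ_ξ : ξ ∈ Uₙ°}` in the dual of
`𝒮`. -/
def nStates (n : ℕ) : Set (WeakDual ℂ SchwartzOp) :=
  closure (convexHull ℝ ((fun ξ => StrongDual.toWeakDual (vectorFunctional ξ)) '' polarBall n))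

/-! ### Fréchet–Hilbert spaces -/

section Hilbert

variable {H : Type*} [AddCommGroup H] [Module ℂ H]

/-- The seminorm `‖h‖ = ⟨h, h⟩^{1/2}` of a (possibly degenerate) inner product. -/
def hilbertSeminorm (c : PreInnerProductSpace.Core ℂ H) : Seminorm ℂ H :=
  letI := @InnerProductSpace.Core.toSeminormedAddCommGroup ℂ H _ _ _ c
  letI := @InnerProductSpace.Core.toNormedSpace ℂ H _ _ _ c
  { toFun := fun h => √(RCLike.re (c.inner h h))
    map_zero' := norm_zero (E := H)
    add_le' := norm_add_le (E := H)
    neg' := norm_neg (E := H)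
    smul' := norm_smul (β := H) }

/-- `‖T‖_{n,k} = sup {‖T x‖ₖ : ‖x‖ₙ ≤ 1} ∈ [0, ∞]`, where `‖·‖ₖ` is the seminorm `q`. -/
def mapNorm [TopologicalSpace H] (n : ℕ) (q : Seminorm ℂ H) (T : SchwartzOp →L[ℂ] H) : ℝ≥0∞ :=
  ⨆ (x : SchwartzOp) (_ : opNorm n x ≤ 1), ENNReal.ofReal (q (T x))

end Hilbert

end NCSchwartz

end

open NCSchwartz

open scoped ENNReal ComplexConjugate Topology

noncomputable section

namespace NCSchwartz

/-! ### The pairing and the involution -/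

/-! The inequality on `𝒮` is a Hilbert–Schmidt estimate. The norm `‖x‖ₙ` is dominated by the
weighted Hilbert–Schmidt norm with square `∑ |x_{pq}|² p^{2n} q^{2n}` (`ofReal_opNorm_sq_le_hsSq`),
and `2 p^{2n} q^{2n} ≤ p^{4n} + q^{4n}` splits this into a row part and a column part
(`two_mul_hsSq_le`). Testing `∑ xⱼ* xⱼ` on `e_p`, whose dual norm of index `2n+1` is `p^{-(2n+1)}`,
gives `∑ⱼ |xⱼ e_p|₀² p^{4n} ≤ ‖∑ xⱼ* xⱼ‖_{2n+1} p^{-2}`. Summing over `p` produces `π²/6`, so `∑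
‖xⱼ‖ₙ² ≤ (π²/6) (‖(xⱼ)‖^{rc})²` (`sum_opNorm_sq_le`). By Cauchy–Schwarz, every bilinear form
satisfies the inequality with constant `π²/6`.

For maps into `H`, the defining property of `Kₙ` (`grothendieckConst_spec`) is applied to the
bilinear form `(x, y) ↦ ⟨u₁ x, u₂ y*⟩`, since the row/column norm is invariant under the involution.
Continuity of this form rests on the norms `‖·‖ₙ` generating the topology of `𝒮`, each being
invariant under the involution.

The states come from convexity. The norm of a positive sum is approached by its values at states, so
the inequality for finite families says that certain affine functions on quadruples of states have
nearly nonnegative weighted sums somewhere. Compactness and Hahn–Banach separation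
(`exists_forall_nonneg_of_affine`) give one quadruple that works for all pairs `(x, y)`, and a
scaling argument turns the sum of squares into a product. If the constant is infinite, a faithful
state (`exists_faithful_nState`) makes the right side infinite unless `x` or `y` vanishes. -/

theorem RapidSeq.val_injective : Function.Injective RapidSeq.val := Subtype.val_injective

theorem SlowSeq.val_injective : Function.Injective SlowSeq.val := Subtype.val_injective

theorem pairing_eq_conj_toDual (ξ : RapidSeq) (η : SlowSeq) : pairing ξ η = conj (toDual η ξ) := by
  rw [toDual_apply, Complex.conj_conj]

theorem pairing_add_left (ξ ζ : RapidSeq) (η : SlowSeq) :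
    pairing (ξ + ζ) η = pairing ξ η + pairing ζ η := by
  simp only [pairing_eq_conj_toDual, map_add]

theorem pairing_smul_left (c : ℂ) (ξ : RapidSeq) (η : SlowSeq) :
    pairing (c • ξ) η = c * pairing ξ η := by
  simp only [pairing_eq_conj_toDual, map_smulₛₗ, smul_eq_mul, map_mul, Complex.conj_conj]

theorem pairing_zero_left (η : SlowSeq) : pairing 0 η = 0 := by
  simp only [pairing_eq_conj_toDual, map_zero]

theorem pairing_sum_left {ι : Type*} (s : Finset ι) (f : ι → RapidSeq) (η : SlowSeq) :
    pairing (∑ i ∈ s, f i) η = ∑ i ∈ s, pairing (f i) η := by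
  simp only [pairing_eq_conj_toDual, map_sum]

theorem toDual_eq_toDualₗ (η : SlowSeq) : toDual η = toDualₗ η := rfl

theorem pairing_smul_right (c : ℂ) (ξ : RapidSeq) (η : SlowSeq) :
    pairing ξ (c • η) = conj c * pairing ξ η := by
  simp only [pairing_eq_conj_toDual, toDual_eq_toDualₗ, map_smul, smul_apply, smul_eq_mul, map_mul]

theorem pairing_slowBasis (ξ : RapidSeq) (p : ℕ+) : pairing ξ (slowBasis p) = ξ.val p := by
  rw [pairing, tsum_eq_single p]
  · simp [slowBasis, slowOfFinset_val]
  · intro j hj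
    simp [slowBasis, slowOfFinset_val, hj]

theorem pairing_iota_symm (ξ ζ : RapidSeq) :
    pairing ξ (iota ζ) = conj (pairing ζ (iota ξ)) := by
  rw [conj_pairing, pairing]
  simp only [iota_val, mul_comm]

theorem wSummable_slowBasis (r : ℤ) (p : ℕ+) : WSummable r (slowBasis p).val :=
  summable_of_ne_finset_zero (s := {p}) fun j hj => by
    simp only [Finset.mem_singleton] at hj
    simp [slowBasis, slowOfFinset_val, hj]

theorem wNorm_slowBasis (r : ℤ) (p : ℕ+) : wNorm r (slowBasis p).val = ((p : ℕ) : ℝ) ^ r := by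
  unfold wNorm
  rw [tsum_eq_single p]
  · simp only [slowBasis, slowOfFinset_val, Finset.mem_singleton, if_true, Pi.one_apply, norm_one,
      one_pow, one_mul]
    rw [mul_comm 2 r, zpow_mul]
    exact Real.sqrt_sq (zpow_nonneg (pnat_cast_pos p).le _)
  · intro j hj
    simp [slowBasis, slowOfFinset_val, hj]

theorem rapidNorm_zero_sq (ξ : RapidSeq) : pairing ξ (iota ξ) = ((rapidNorm 0 ξ ^ 2 : ℝ) : ℂ) := by
  rw [rapidNorm_apply, wNorm_sq, pairing, Complex.ofReal_tsum]
  refine tsum_congr fun j => ?_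
  rw [iota_val, Complex.mul_conj, Complex.normSq_eq_norm_sq]
  simp

theorem norm_pairing_iota_le (ξ ζ : RapidSeq) :
    ‖pairing ξ (iota ζ)‖ ≤ rapidNorm 0 ξ * rapidNorm 0 ζ := by
  have h := norm_pairing_le ξ (iota ζ) (n := 0) (by simpa [iota_val] using ζ.summable 0)
  simpa [rapidNorm_apply, iota_val] using h

/-- The source of positivity: for `x = y` and `ξ = η` the right side is `|x ξ|₀²`. -/
theorem pairing_star_mul (x y : SchwartzOp) (η ξ : SlowSeq) :
    pairing ((star x * y) η) ξ = pairing (y η) (iota (x ξ)) := by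
  rw [mul_apply', pairing_star, pairing_iota_symm (y η)]

theorem star_apply_val' (x : SchwartzOp) (ξ : SlowSeq) (p : ℕ+) :
    (star x ξ).val p = conj (pairing (x (slowBasis p)) ξ) := rfl

theorem star_star' (x : SchwartzOp) : star (star x) = x := by
  refine ContinuousLinearMap.ext fun ξ => RapidSeq.val_injective (funext fun p => ?_)
  rw [star_apply_val', pairing_star, Complex.conj_conj, pairing_slowBasis]

theorem star_add' (x y : SchwartzOp) : star (x + y) = star x + star y := by
  refine ContinuousLinearMap.ext fun ξ => RapidSeq.val_injective (funext fun p => ?_)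
  rw [star_apply_val', add_apply, pairing_add_left, map_add, add_apply, map_add, Pi.add_apply,
    star_apply_val', star_apply_val']

theorem star_smul' (c : ℂ) (x : SchwartzOp) : star (c • x) = conj c • star x := by
  refine ContinuousLinearMap.ext fun ξ => RapidSeq.val_injective (funext fun p => ?_)
  rw [star_apply_val', smul_apply, pairing_smul_left, map_mul, smul_apply, map_smul, Pi.smul_apply,
    star_apply_val', smul_eq_mul]

theorem star_smul_mul_smul (c : ℂ) (x : SchwartzOp) :
    star (c • x) * (c • x) = ((‖c‖ ^ 2 : ℝ) : ℂ) • (star x * x) := by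
  rw [star_smul', ← Complex.normSq_eq_norm_sq, Complex.normSq_eq_conj_mul_self]
  ext1 η
  simp only [mul_apply', smul_apply, map_smul, smul_smul, mul_comm]

theorem smul_mul_star_smul (c : ℂ) (x : SchwartzOp) :
    (c • x) * star (c • x) = ((‖c‖ ^ 2 : ℝ) : ℂ) • (x * star x) := by
  have h := star_smul_mul_smul (conj c) (star x)
  rwa [← star_smul', star_star', star_star', RCLike.norm_conj] at h

/-! ### The norms of `𝒮` -/

theorem zero_mem_polarBall (n : ℕ) : (0 : SlowSeq) ∈ polarBall n :=
  ⟨by rw [map_zero]; exact wSummable_zero _, by rw [map_zero]; simp [wNorm]⟩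

theorem polarBall_mono {n m : ℕ} (h : n ≤ m) : polarBall n ⊆ polarBall m := by
  intro η hη
  refine ⟨hη.1.mono (by omega), le_trans (Real.sqrt_le_sqrt ?_) hη.2⟩
  refine (hη.1.mono (by omega : -(m : ℤ) ≤ -n)).tsum_le_tsum (fun j => ?_) hη.1
  refine mul_le_mul_of_nonneg_left ?_ (sq_nonneg _)
  exact zpow_le_zpow_right₀ (by exact_mod_cast j.pos) (by omega)

theorem rapidNorm_mono {n m : ℕ} (h : n ≤ m) (ξ : RapidSeq) : rapidNorm n ξ ≤ rapidNorm m ξ := by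
  rw [rapidNorm_apply, rapidNorm_apply]
  refine Real.sqrt_le_sqrt ((ξ.summable n).tsum_le_tsum (fun j => ?_) (ξ.summable m))
  refine mul_le_mul_of_nonneg_left ?_ (sq_nonneg _)
  exact zpow_le_zpow_right₀ (by exact_mod_cast j.pos) (by omega)

theorem rapidNorm_le_opNorm {n : ℕ} (x : SchwartzOp) {η : SlowSeq} (hη : η ∈ polarBall n) :
    rapidNorm n (x η) ≤ opNorm n x :=
  le_ciSup (opNorm_bddAbove n x) ⟨η, hη⟩

theorem opNorm_nonneg (n : ℕ) (x : SchwartzOp) : 0 ≤ opNorm n x :=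
  (apply_nonneg _ _).trans (rapidNorm_le_opNorm x (zero_mem_polarBall n))

theorem opNorm_le {n : ℕ} {x : SchwartzOp} {M : ℝ}
    (h : ∀ η ∈ polarBall n, rapidNorm n (x η) ≤ M) : opNorm n x ≤ M :=
  haveI : Nonempty (polarBall n) := ⟨⟨0, zero_mem_polarBall n⟩⟩
  ciSup_le fun η => h η η.2

theorem smul_mem_polarBall {n : ℕ} {η : SlowSeq} (hη : WSummable (-n) η.val) {c : ℂ}
    (hc : ‖c‖ * wNorm (-n) η.val ≤ 1) : c • η ∈ polarBall n := by
  refine ⟨?_, ?_⟩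
  · rw [map_smul]; exact hη.smul _
  · rwa [map_smul, wNorm_smul]

theorem rapidNorm_apply_le (n : ℕ) (x : SchwartzOp) {η : SlowSeq} (hη : WSummable (-n) η.val) :
    rapidNorm n (x η) ≤ opNorm n x * wNorm (-n) η.val := by
  refine le_of_forall_pos_le_add fun ε hε => ?_
  obtain ⟨δ, hδ, hδε⟩ : ∃ δ > 0, opNorm n x * δ ≤ ε := by
    refine ⟨ε / (opNorm n x + 1), div_pos hε (by linarith [opNorm_nonneg n x]), ?_⟩
    rw [mul_div_assoc', div_le_iff₀ (by linarith [opNorm_nonneg n x])]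
    nlinarith [opNorm_nonneg n x]
  -- The slack `δ` avoids dividing by a vanishing norm of `η`.
  set W := wNorm (-n) η.val + δ with hW
  have hW0 : 0 < W := by have := wNorm_nonneg (-n) η.val; linarith
  have hn : ‖((W⁻¹ : ℝ) : ℂ)‖ = W⁻¹ := by
    rw [Complex.norm_real, Real.norm_of_nonneg (by positivity)]
  have hm : ((W⁻¹ : ℝ) : ℂ) • η ∈ polarBall n := by
    refine smul_mem_polarBall hη ?_
    rw [hn, inv_mul_eq_div, div_le_one hW0]
    linarith
  have h := rapidNorm_le_opNorm x hm
  rw [map_smul, map_smul_eq_mul, hn, inv_mul_eq_div, div_le_iff₀ hW0] at h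
  rw [hW] at h
  linarith

theorem norm_pairing_apply_le {n : ℕ} (x : SchwartzOp) {η ξ : SlowSeq} (hη : η ∈ polarBall n)
    (hξ : ξ ∈ polarBall n) : ‖pairing (x η) ξ‖ ≤ opNorm n x :=
  (norm_pairing_le _ _ hξ.1).trans <| (mul_le_of_le_one_right (apply_nonneg _ _) hξ.2).trans
    (rapidNorm_le_opNorm x hη)

/-- The norm `|·|ₙ` on `s` is dual to `|·|'ₙ`. Since `x ξ` is the adjoint sequence of `star x` at
`ξ`, `adjSeq_bound` supplies this duality. -/
theorem opNorm_le_of_pairing {n : ℕ} {x : SchwartzOp} {M : ℝ}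
    (h : ∀ η ∈ polarBall n, ∀ ξ ∈ polarBall n, ‖pairing (x η) ξ‖ ≤ M) : opNorm n x ≤ M := by
  refine opNorm_le fun ξ hξ => ?_
  have := (adjSeq_bound (star x) ξ n (M := M) fun η hη => ?_).2
  · rwa [← star_apply_val, star_star'] at this
  · rw [pairing_star, RCLike.norm_conj]
    exact h ξ hξ η hη

theorem opNorm_star (n : ℕ) (x : SchwartzOp) : opNorm n (star x) = opNorm n x := by
  have key : ∀ y : SchwartzOp, opNorm n (star y) ≤ opNorm n y := fun y =>
    opNorm_le_of_pairing fun η hη ξ hξ => by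
      rw [pairing_star, RCLike.norm_conj]
      exact norm_pairing_apply_le y hξ hη
  exact le_antisymm (key x) (by simpa only [star_star'] using key (star x))

theorem rcNorm_star (k : ℕ) {m : ℕ} (x : Fin m → SchwartzOp) :
    rcNorm k (fun j => star (x j)) = rcNorm k x := by
  simp only [rcNorm, star_star']
  exact max_comm _ _

/-- The norm `‖·‖ₙ` as a seminorm. -/
def opSeminorm (n : ℕ) : Seminorm ℂ SchwartzOp :=
  Seminorm.ofSMulLE (opNorm n)
    (le_antisymm (opNorm_le fun η _ => by rw [zero_apply, map_zero]) (opNorm_nonneg _ _))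
    (fun x y => opNorm_le fun η hη => (map_add_le_add _ _ _).trans
      (add_le_add (rapidNorm_le_opNorm x hη) (rapidNorm_le_opNorm y hη)))
    (fun c x => opNorm_le fun η hη => by
      rw [smul_apply, map_smul_eq_mul]
      exact mul_le_mul_of_nonneg_left (rapidNorm_le_opNorm x hη) (norm_nonneg _))

theorem opSeminorm_apply (n : ℕ) (x : SchwartzOp) : opSeminorm n x = opNorm n x := rfl

/-- Positive elements attain their norm on the diagonal. -/
theorem opNorm_sum_star_mul_le {n m : ℕ} (x : Fin m → SchwartzOp) {M : ℝ}
    (h : ∀ η ∈ polarBall n, ∑ j, rapidNorm 0 (x j η) ^ 2 ≤ M) :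
    opNorm n (∑ j, star (x j) * x j) ≤ M := by
  refine opNorm_le_of_pairing fun η hη ξ hξ => ?_
  have hM : 0 ≤ M := (Finset.sum_nonneg fun j _ => sq_nonneg _).trans (h η hη)
  rw [sum_apply, pairing_sum_left]
  calc ‖∑ j, pairing ((star (x j) * x j) η) ξ‖
      ≤ ∑ j, rapidNorm 0 (x j η) * rapidNorm 0 (x j ξ) := by
        refine (norm_sum_le _ _).trans (Finset.sum_le_sum fun j _ => ?_)
        rw [pairing_star_mul]
        exact norm_pairing_iota_le _ _
    _ ≤ √(∑ j, rapidNorm 0 (x j η) ^ 2) * √(∑ j, rapidNorm 0 (x j ξ) ^ 2) :=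
        Real.sum_mul_le_sqrt_mul_sqrt _ _ _
    _ ≤ √M * √M := by gcongr <;> apply h <;> assumption
    _ = M := Real.mul_self_sqrt hM

/-- The left side is the value of the quadratic form of `∑ xⱼ* xⱼ` at `η`. -/
theorem sum_rapidNorm_sq_le (k : ℕ) {m : ℕ} (x : Fin m → SchwartzOp) {η : SlowSeq}
    (hη : WSummable (-k) η.val) :
    ∑ j, rapidNorm 0 (x j η) ^ 2 ≤ opNorm k (∑ j, star (x j) * x j) * wNorm (-k) η.val ^ 2 := by
  have h1 : pairing ((∑ j, star (x j) * x j) η) η = ((∑ j, rapidNorm 0 (x j η) ^ 2 : ℝ) : ℂ) := by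
    rw [sum_apply, pairing_sum_left, Complex.ofReal_sum]
    exact Finset.sum_congr rfl fun j _ => by rw [pairing_star_mul, rapidNorm_zero_sq]
  have h2 := norm_pairing_le ((∑ j, star (x j) * x j) η) η hη
  rw [h1, Complex.norm_real, Real.norm_of_nonneg (Finset.sum_nonneg fun j _ => sq_nonneg _)] at h2
  refine h2.trans ?_
  rw [sq, ← mul_assoc]
  exact mul_le_mul_of_nonneg_right (rapidNorm_apply_le _ _ hη) (wNorm_nonneg _ _)

/-! ### Hilbert–Schmidt norms -/

/-- The square of the weighted Hilbert–Schmidt norm, `∑_{p,q} |x_{pq}|² p^{2n} q^{2n}`. -/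
def hsSq (n : ℕ) (x : SchwartzOp) : ℝ≥0∞ :=
  ∑' p : ℕ+, ∑' q : ℕ+, ENNReal.ofReal (‖(x (slowBasis q)).val p‖ ^ 2 *
    (((p : ℕ) : ℝ) ^ (2 * (n : ℤ)) * ((q : ℕ) : ℝ) ^ (2 * (n : ℤ))))

theorem ofReal_rapidNorm_sq (n : ℕ) (ξ : RapidSeq) :
    ENNReal.ofReal (rapidNorm n ξ ^ 2) =
      ∑' j : ℕ+, ENNReal.ofReal (‖ξ.val j‖ ^ 2 * ((j : ℕ) : ℝ) ^ (2 * (n : ℤ))) := by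
  rw [rapidNorm_apply, wNorm_sq, ENNReal.ofReal_tsum_of_nonneg (w_term_nonneg _ _) (ξ.summable n)]

theorem star_slowBasis_val (x : SchwartzOp) (p q : ℕ+) :
    ‖(star x (slowBasis p)).val q‖ = ‖(x (slowBasis q)).val p‖ := by
  rw [star_apply_val', RCLike.norm_conj, pairing_slowBasis]

/-- Up to conjugation, `x* e_p` is the `p`-th row of the matrix of `x`. -/
theorem tsum_rapidNorm_star_slowBasis (n k : ℕ) (x : SchwartzOp) (p : ℕ+) :
    ENNReal.ofReal (rapidNorm n (star x (slowBasis p)) ^ 2 * ((p : ℕ) : ℝ) ^ (2 * (k : ℤ))) =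
      ∑' q : ℕ+, ENNReal.ofReal (‖(x (slowBasis q)).val p‖ ^ 2 *
        (((p : ℕ) : ℝ) ^ (2 * (k : ℤ)) * ((q : ℕ) : ℝ) ^ (2 * (n : ℤ)))) := by
  rw [ENNReal.ofReal_mul (sq_nonneg _), ofReal_rapidNorm_sq, ← ENNReal.tsum_mul_right]
  refine tsum_congr fun q => ?_
  rw [← ENNReal.ofReal_mul (w_term_nonneg _ _ _), star_slowBasis_val]
  congr 1
  ring

/-- Up to conjugation, the `p`-th coordinate of `x η` is the pairing of `η` with `x* e_p`, hence at
most the weighted norm of the `p`-th row. -/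
theorem ofReal_opNorm_sq_le_hsSq (n : ℕ) (x : SchwartzOp) :
    ENNReal.ofReal (opNorm n x ^ 2) ≤ hsSq n x := by
  have key : ∀ η ∈ polarBall n, ENNReal.ofReal (rapidNorm n (x η) ^ 2) ≤ hsSq n x := by
    intro η hη
    rw [ofReal_rapidNorm_sq]
    refine ENNReal.tsum_le_tsum fun p => ?_
    rw [← tsum_rapidNorm_star_slowBasis]
    refine ENNReal.ofReal_le_ofReal (mul_le_mul_of_nonneg_right ?_
      (zpow_nonneg (pnat_cast_pos p).le _))
    refine pow_le_pow_left₀ (norm_nonneg _) ?_ 2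
    rw [← pairing_slowBasis, ← RCLike.norm_conj, ← pairing_star]
    exact (norm_pairing_le _ _ hη.1).trans (mul_le_of_le_one_right (apply_nonneg _ _) hη.2)
  rcases eq_or_ne (hsSq n x) ⊤ with h | h
  · rw [h]; exact le_top
  rw [ENNReal.ofReal_le_iff_le_toReal h, ← Real.le_sqrt (opNorm_nonneg _ _) ENNReal.toReal_nonneg]
  refine opNorm_le fun η hη => ?_
  rw [Real.le_sqrt (apply_nonneg _ _) ENNReal.toReal_nonneg, ← ENNReal.ofReal_le_iff_le_toReal h]
  exact key η hη

/-- Entrywise this is `2ab ≤ a² + b²` with `a = p^{2n}`, `b = q^{2n}`. Each term on the right then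
carries a weight in one index only, at the price of doubling `n`. -/
theorem two_mul_hsSq_le (n : ℕ) (x : SchwartzOp) :
    2 * hsSq n x ≤
      (∑' p : ℕ+, ENNReal.ofReal (rapidNorm 0 (star x (slowBasis p)) ^ 2 *
        ((p : ℕ) : ℝ) ^ (2 * ((2 * n : ℕ) : ℤ)))) +
      ∑' p : ℕ+, ENNReal.ofReal (rapidNorm 0 (x (slowBasis p)) ^ 2 *
        ((p : ℕ) : ℝ) ^ (2 * ((2 * n : ℕ) : ℤ))) := by
  have h2 : ∀ p, ENNReal.ofReal (rapidNorm 0 (x (slowBasis p)) ^ 2 *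
        ((p : ℕ) : ℝ) ^ (2 * ((2 * n : ℕ) : ℤ))) =
      ∑' q : ℕ+, ENNReal.ofReal (‖(x (slowBasis p)).val q‖ ^ 2 *
        (((p : ℕ) : ℝ) ^ (2 * ((2 * n : ℕ) : ℤ)) * ((q : ℕ) : ℝ) ^ (2 * ((0 : ℕ) : ℤ)))) := by
    intro p
    have h := tsum_rapidNorm_star_slowBasis 0 (2 * n) (star x) p
    rw [star_star'] at h
    simpa only [star_slowBasis_val] using h
  simp only [tsum_rapidNorm_star_slowBasis, h2]
  rw [ENNReal.tsum_comm (f := fun p q : ℕ+ => ENNReal.ofReal (‖(x (slowBasis p)).val q‖ ^ 2 * _)),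
    hsSq, ← ENNReal.tsum_add, ← ENNReal.tsum_mul_left]
  refine ENNReal.tsum_le_tsum fun p => ?_
  rw [← ENNReal.tsum_add, ← ENNReal.tsum_mul_left]
  refine ENNReal.tsum_le_tsum fun q => ?_
  have hp := pnat_cast_pos p
  have hq := pnat_cast_pos q
  rw [← ENNReal.ofReal_add (by positivity) (by positivity),
    show (2 : ℝ≥0∞) = ENNReal.ofReal 2 by simp, ← ENNReal.ofReal_mul (by norm_num)]
  refine ENNReal.ofReal_le_ofReal ?_
  have e : ∀ t : ℝ, t ^ (2 * ((2 * n : ℕ) : ℤ)) = (t ^ (2 * (n : ℤ))) ^ 2 := by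
    intro t
    rw [← zpow_natCast, ← zpow_mul]
    congr 1
    push_cast
    ring
  rw [e, e]
  have := mul_nonneg (sq_nonneg ‖(x (slowBasis q)).val p‖)
    (sq_nonneg (((p : ℕ) : ℝ) ^ (2 * (n : ℤ)) - ((q : ℕ) : ℝ) ^ (2 * (n : ℤ))))
  simp only [Nat.cast_zero, mul_zero, zpow_zero, mul_one]
  nlinarith [this]

theorem tsum_pnat_inv_sq_le :
    ∑' p : ℕ+, ENNReal.ofReal (((p : ℕ) : ℝ) ^ (-2 : ℤ)) ≤ ENNReal.ofReal (Real.pi ^ 2 / 6) := by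
  have h : ∀ k : ℕ, 0 ≤ 1 / (k : ℝ) ^ 2 := fun k => by positivity
  rw [← hasSum_zeta_two.tsum_eq, ENNReal.ofReal_tsum_of_nonneg h hasSum_zeta_two.summable]
  refine le_trans (le_of_eq (tsum_congr fun p => ?_))
    (ENNReal.tsum_comp_le_tsum_of_injective PNat.coe_injective _)
  rw [zpow_neg, one_div]
  norm_cast

/-- The index `2n+1` rather than `2n` leaves the factor `p^{4n} p^{-2(2n+1)} = p^{-2}`, which is
summable. -/
theorem sum_tsum_rapidNorm_slowBasis_le (n : ℕ) {m : ℕ} (x : Fin m → SchwartzOp) :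
    ∑ j, ∑' p : ℕ+, ENNReal.ofReal (rapidNorm 0 (x j (slowBasis p)) ^ 2 *
        ((p : ℕ) : ℝ) ^ (2 * ((2 * n : ℕ) : ℤ))) ≤
      ENNReal.ofReal (Real.pi ^ 2 / 6) *
        ENNReal.ofReal (opNorm (2 * n + 1) (∑ j, star (x j) * x j)) := by
  rw [← Summable.tsum_finsetSum fun _ _ => ENNReal.summable]
  refine le_trans ?_ (mul_le_mul_left tsum_pnat_inv_sq_le _)
  rw [← ENNReal.tsum_mul_right]
  refine ENNReal.tsum_le_tsum fun p => ?_
  have hp := pnat_cast_pos p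
  rw [← ENNReal.ofReal_sum_of_nonneg fun j _ => by positivity,
    ← ENNReal.ofReal_mul (by positivity), ← Finset.sum_mul]
  refine ENNReal.ofReal_le_ofReal ?_
  have h := sum_rapidNorm_sq_le (2 * n + 1) x (wSummable_slowBasis (-(2 * n + 1 : ℕ)) p)
  rw [wNorm_slowBasis] at h
  refine (mul_le_mul_of_nonneg_right h (by positivity)).trans (le_of_eq ?_)
  rw [mul_assoc, mul_comm]
  congr 1
  rw [← zpow_natCast, ← zpow_mul, ← zpow_add₀ hp.ne']
  congr 1
  push_cast
  ring

theorem rcNorm_nonneg (k : ℕ) {m : ℕ} (x : Fin m → SchwartzOp) : 0 ≤ rcNorm k x :=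
  (Real.sqrt_nonneg _).trans (le_max_left _ _)

theorem opNorm_le_rcNorm_sq (k : ℕ) {m : ℕ} (x : Fin m → SchwartzOp) :
    opNorm k (∑ j, star (x j) * x j) ≤ rcNorm k x ^ 2 := by
  rw [← Real.sqrt_le_left (rcNorm_nonneg _ _)]
  exact le_max_left _ _

/-- The column bound for `x` and for `x*` controls the two halves of `two_mul_hsSq_le`; the factor
`2` cancels. -/
theorem sum_hsSq_le (n : ℕ) {m : ℕ} (x : Fin m → SchwartzOp) :
    ∑ j, hsSq n (x j) ≤
      ENNReal.ofReal (Real.pi ^ 2 / 6) * ENNReal.ofReal (rcNorm (2 * n + 1) x ^ 2) := by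
  have key : ∀ y : Fin m → SchwartzOp,
      ∑ j, ∑' p : ℕ+, ENNReal.ofReal (rapidNorm 0 (y j (slowBasis p)) ^ 2 *
        ((p : ℕ) : ℝ) ^ (2 * ((2 * n : ℕ) : ℤ))) ≤
      ENNReal.ofReal (Real.pi ^ 2 / 6) * ENNReal.ofReal (rcNorm (2 * n + 1) y ^ 2) := fun y =>
    (sum_tsum_rapidNorm_slowBasis_le n y).trans
      (mul_le_mul_right (ENNReal.ofReal_le_ofReal (opNorm_le_rcNorm_sq _ _)) _)
  have h1 := key x
  have h2 := key fun j => star (x j)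
  rw [rcNorm_star] at h2
  have h3 := Finset.sum_le_sum fun j (_ : j ∈ Finset.univ) => two_mul_hsSq_le n (x j)
  rw [← Finset.mul_sum, Finset.sum_add_distrib] at h3
  have h4 := h3.trans (add_le_add h2 h1)
  rw [← two_mul] at h4
  exact (ENNReal.mul_le_mul_iff_right (by simp) (by simp)).1 h4

/-! ### The bound `K ≤ π² / 6` -/

theorem sum_opNorm_sq_le (n : ℕ) {m : ℕ} (x : Fin m → SchwartzOp) :
    ∑ j, opNorm n (x j) ^ 2 ≤ Real.pi ^ 2 / 6 * rcNorm (2 * n + 1) x ^ 2 := by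
  have h := (Finset.sum_le_sum fun j (_ : j ∈ Finset.univ) =>
    ofReal_opNorm_sq_le_hsSq n (x j)).trans (sum_hsSq_le n x)
  rwa [← ENNReal.ofReal_sum_of_nonneg fun j _ => sq_nonneg _,
    ← ENNReal.ofReal_mul (by positivity), ENNReal.ofReal_le_ofReal_iff (by positivity)] at h

theorem sum_opNorm_mul_opNorm_le (n : ℕ) {m : ℕ} (x y : Fin m → SchwartzOp) :
    ∑ j, opNorm n (x j) * opNorm n (y j) ≤
      Real.pi ^ 2 / 6 * rcNorm (2 * n + 1) x * rcNorm (2 * n + 1) y := by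
  refine (Real.sum_mul_le_sqrt_mul_sqrt _ _ _).trans ?_
  refine (mul_le_mul (Real.sqrt_le_sqrt (sum_opNorm_sq_le n x))
    (Real.sqrt_le_sqrt (sum_opNorm_sq_le n y)) (Real.sqrt_nonneg _)
    (Real.sqrt_nonneg _)).trans (le_of_eq ?_)
  rw [Real.sqrt_mul (by positivity), Real.sqrt_mul (by positivity),
    Real.sqrt_sq (rcNorm_nonneg _ _), Real.sqrt_sq (rcNorm_nonneg _ _)]
  have := Real.mul_self_sqrt (show 0 ≤ Real.pi ^ 2 / 6 by positivity)
  linear_combination rcNorm (2 * n + 1) x * rcNorm (2 * n + 1) y * this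

/-- Definiteness makes the homogeneity bound for `bilinNorm` valid even when that norm is infinite,
where `∞ · 0 = 0`. The operator `x` kills each `e_q`, so each `x* e_p` is zero, and pairing with it
gives the coordinates of `x ξ`. -/
theorem eq_zero_of_opNorm_eq_zero {n : ℕ} {x : SchwartzOp} (h : opNorm n x = 0) : x = 0 := by
  refine ContinuousLinearMap.ext fun ξ => RapidSeq.val_injective (funext fun p => ?_)
  obtain ⟨k, hk⟩ := ξ.2
  have hb : ∀ q, x (slowBasis q) = 0 := by
    intro q
    have h1 := rapidNorm_apply_le n x (wSummable_slowBasis (-n) q)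
    rw [h, zero_mul] at h1
    refine RapidSeq.val_injective (funext fun p => ?_)
    have h2 := norm_pairing_le (x (slowBasis q)) (slowBasis p) (wSummable_slowBasis (-n) p)
    rw [le_antisymm h1 (apply_nonneg _ _), zero_mul, pairing_slowBasis, norm_le_zero_iff] at h2
    rw [h2, map_zero, Pi.zero_apply]
  rw [← pairing_slowBasis, ← Complex.conj_conj (pairing _ _), ← pairing_star]
  have : star x (slowBasis p) = 0 := by
    refine RapidSeq.val_injective (funext fun q => ?_)
    rw [star_apply_val', hb, pairing_zero_left, map_zero, map_zero, Pi.zero_apply]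
  rw [this, pairing_zero_left, map_zero, zero_apply, map_zero, Pi.zero_apply]

theorem opNorm_smul (n : ℕ) (c : ℂ) (x : SchwartzOp) : opNorm n (c • x) = ‖c‖ * opNorm n x :=
  map_smul_eq_mul (opSeminorm n) c x

theorem enorm_le_bilinNorm_mul (n : ℕ) (u : SchwartzOp →ₗ[ℂ] SchwartzOp →ₗ[ℂ] ℂ)
    (x y : SchwartzOp) :
    ‖u x y‖ₑ ≤ bilinNorm n u * ENNReal.ofReal (opNorm n x * opNorm n y) := by
  rcases (opNorm_nonneg n x).eq_or_lt with hx | hx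
  · rw [eq_zero_of_opNorm_eq_zero hx.symm]; simp
  rcases (opNorm_nonneg n y).eq_or_lt with hy | hy
  · rw [eq_zero_of_opNorm_eq_zero hy.symm]; simp
  have hnorm : ∀ z : SchwartzOp, 0 < opNorm n z →
      opNorm n ((((opNorm n z)⁻¹ : ℝ) : ℂ) • z) ≤ 1 := by
    intro z hz
    rw [opNorm_smul, Complex.norm_real, Real.norm_of_nonneg (by positivity),
      inv_mul_cancel₀ hz.ne']
  have h : ‖u ((((opNorm n x)⁻¹ : ℝ) : ℂ) • x) ((((opNorm n y)⁻¹ : ℝ) : ℂ) • y)‖ₑ ≤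
      bilinNorm n u :=
    le_iSup₂_of_le _ (hnorm x hx) (le_iSup₂_of_le _ (hnorm y hy) le_rfl)
  refine le_trans (le_of_eq ?_) (mul_le_mul_left h _)
  simp only [map_smul, LinearMap.smul_apply, smul_eq_mul]
  rw [← ofReal_norm, ← ofReal_norm, ← ENNReal.ofReal_mul (norm_nonneg _)]
  simp only [norm_mul, Complex.norm_real, norm_inv, Real.norm_of_nonneg hx.le,
    Real.norm_of_nonneg hy.le]
  congr 1
  field_simp

theorem grothendieck_inequality (n : ℕ) (u : SchwartzOp →ₗ[ℂ] SchwartzOp →ₗ[ℂ] ℂ) {m : ℕ}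
    (x y : Fin m → SchwartzOp) :
    ‖∑ j, u (x j) (y j)‖ₑ ≤ ENNReal.ofReal (Real.pi ^ 2 / 6) * bilinNorm n u *
      ENNReal.ofReal (rcNorm (2 * n + 1) x) * ENNReal.ofReal (rcNorm (2 * n + 1) y) := by
  calc ‖∑ j, u (x j) (y j)‖ₑ
      ≤ ∑ j, bilinNorm n u * ENNReal.ofReal (opNorm n (x j) * opNorm n (y j)) :=
        (enorm_sum_le _ _).trans (Finset.sum_le_sum fun j _ => enorm_le_bilinNorm_mul _ _ _ _)
    _ = bilinNorm n u * ENNReal.ofReal (∑ j, opNorm n (x j) * opNorm n (y j)) := by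
        rw [← Finset.mul_sum, ENNReal.ofReal_sum_of_nonneg fun j _ =>
          mul_nonneg (opNorm_nonneg _ _) (opNorm_nonneg _ _)]
    _ ≤ bilinNorm n u * ENNReal.ofReal
          (Real.pi ^ 2 / 6 * rcNorm (2 * n + 1) x * rcNorm (2 * n + 1) y) := by
        gcongr
        exact sum_opNorm_mul_opNorm_le n x y
    _ = _ := by
        rw [ENNReal.ofReal_mul (mul_nonneg (by positivity) (rcNorm_nonneg _ _)),
          ENNReal.ofReal_mul (by positivity)]
        ring

theorem grothendieckConst_le (n : ℕ) :
    grothendieckConst n ≤ ENNReal.ofReal (Real.pi ^ 2 / 6) :=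
  sInf_le fun u _ _ x y => grothendieck_inequality n u x y

theorem grothendieckK_le : grothendieckK ≤ ENNReal.ofReal (Real.pi ^ 2 / 6) :=
  iSup₂_le fun n _ => grothendieckConst_le n

/-! ### The topology of `𝒮` -/

/-- The standard basis vectors as elements of `s`. -/
def rapidBasis (p : ℕ+) : RapidSeq := ⟨(slowBasis p).val, fun n => wSummable_slowBasis n p⟩

theorem rapidBasis_val (p : ℕ+) : (rapidBasis p).val = (slowBasis p).val := rfl

theorem rapidNorm_rapidBasis (n : ℕ) (p : ℕ+) : rapidNorm n (rapidBasis p) = ((p : ℕ) : ℝ) ^ n := by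
  rw [rapidNorm_apply, rapidBasis_val, wNorm_slowBasis, zpow_natCast]

theorem pairing_rapidBasis (p : ℕ+) (η : SlowSeq) : pairing (rapidBasis p) η = conj (η.val p) := by
  rw [pairing, tsum_eq_single p]
  · simp [rapidBasis_val, slowBasis, slowOfFinset_val]
  · intro j hj
    simp [rapidBasis_val, slowBasis, slowOfFinset_val, hj]

theorem isVonNBounded_polarBall (n : ℕ) : Bornology.IsVonNBounded ℂ (polarBall n) := by
  rw [slow_hasBasis.isVonNBounded_iff]
  rintro ⟨B, ε⟩ ⟨hB, hε⟩
  obtain ⟨C, hC, hBC⟩ := rapid_isVonNBounded_iff.1 hB n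
  refine Absorbs.of_norm ⟨C / ε, fun c hc η hη => ?_⟩
  have hc0 : 0 < ‖c‖ := lt_of_lt_of_le (by positivity) hc
  have hcne : c ≠ 0 := norm_pos_iff.1 hc0
  rw [Set.mem_smul_set_iff_inv_smul_mem₀ hcne]
  intro ξ hξ
  rw [pairing_smul_right, norm_mul, RCLike.norm_conj, norm_inv, inv_mul_lt_iff₀ hc0]
  calc ‖pairing ξ η‖ ≤ rapidNorm n ξ :=
        (norm_pairing_le _ _ hη.1).trans (mul_le_of_le_one_right (apply_nonneg _ _) hη.2)
    _ < C := hBC ξ hξ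
    _ ≤ ‖c‖ * ε := by rwa [div_le_iff₀ hε] at hc

/-- A uniform boundedness argument by hand: violations of the bound for every `m` yield a bounded
sequence in `s` on which `B` is unbounded. -/
theorem exists_pointwise_bound {B : Set SlowSeq} (hB : Bornology.IsVonNBounded ℂ B) :
    ∃ m : ℕ, ∀ ξ ∈ B, ∀ j : ℕ+, ‖ξ.val j‖ ≤ m * ((j : ℕ) : ℝ) ^ m := by
  by_contra! hcon
  choose ξ hξB j hj using hcon
  let a : ℕ → RapidSeq := fun m => ((((j m : ℕ) : ℝ) ^ m)⁻¹ : ℂ) • rapidBasis (j m)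
  have hpos : ∀ m, 0 < ((j m : ℕ) : ℝ) ^ m := fun m => pow_pos (pnat_cast_pos _) _
  have hnorm : ∀ m, ‖((((j m : ℕ) : ℝ) ^ m)⁻¹ : ℂ)‖ = (((j m : ℕ) : ℝ) ^ m)⁻¹ := by
    intro m
    rw [← Complex.ofReal_pow, ← Complex.ofReal_inv, Complex.norm_real,
      Real.norm_of_nonneg (inv_nonneg.2 (hpos m).le)]
  have ha : Bornology.IsVonNBounded ℂ (Set.range a) := by
    rw [rapid_isVonNBounded_iff]
    intro n
    -- The terms with `m ≥ n` have norm at most `1`; the finitely many others are absorbed in the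
    -- sum.
    refine ⟨2 + ∑ m ∈ Finset.range n, rapidNorm n (a m), ?_, ?_⟩
    · have := Finset.sum_nonneg fun m (_ : m ∈ Finset.range n) => apply_nonneg (rapidNorm n) (a m)
      linarith
    rintro _ ⟨m, rfl⟩
    rcases lt_or_ge m n with h | h
    · have := Finset.single_le_sum (fun i _ => apply_nonneg (rapidNorm n) (a i))
        (Finset.mem_range.2 h)
      linarith
    · have h0 := Finset.sum_nonneg fun m (_ : m ∈ Finset.range n) => apply_nonneg (rapidNorm n) (a m)
      have h1 : rapidNorm n (a m) ≤ 1 := by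
        rw [map_smul_eq_mul, hnorm, rapidNorm_rapidBasis, inv_mul_le_one₀ (hpos m)]
        exact pow_le_pow_right₀ (by exact_mod_cast (j m).pos) h
      linarith
  have hV := slow_hasBasis.mem_of_mem (i := (Set.range a, 1)) ⟨ha, one_pos⟩
  obtain ⟨r, hr, hr2⟩ := (hB hV).exists_pos
  obtain ⟨m, hm⟩ := exists_nat_gt r
  have hsub := hr2 (r : ℂ) (by rw [Complex.norm_real, Real.norm_of_nonneg hr.le]) (hξB m)
  have hrne : (r : ℂ) ≠ 0 := by exact_mod_cast hr.ne'
  rw [Set.mem_smul_set_iff_inv_smul_mem₀ hrne] at hsub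
  have h1 := hsub (a m) ⟨m, rfl⟩
  rw [pairing_smul_right, pairing_smul_left, pairing_rapidBasis, norm_mul, norm_mul, hnorm,
    RCLike.norm_conj, RCLike.norm_conj, norm_inv, Complex.norm_real, Real.norm_of_nonneg hr.le,
    inv_mul_lt_iff₀ hr, inv_mul_lt_iff₀ (hpos m)] at h1
  have h2 := hj m
  have h3 := mul_lt_mul_of_pos_right hm (hpos m)
  linarith

/-- Bounded subsets of `s'` are contained in multiples of some `Uₙ°`. -/
theorem exists_wNorm_bound {B : Set SlowSeq} (hB : Bornology.IsVonNBounded ℂ B) :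
    ∃ (m : ℕ) (C : ℝ), 0 < C ∧ ∀ ξ ∈ B, WSummable (-m) ξ.val ∧ wNorm (-m) ξ.val ≤ C := by
  obtain ⟨m, hm⟩ := exists_pointwise_bound hB
  have hS : Summable fun j : ℕ+ => (m : ℝ) ^ 2 * (((j : ℕ) : ℝ) ^ 2)⁻¹ :=
    ((Real.summable_nat_pow_inv.2 one_lt_two).comp_injective PNat.coe_injective).mul_left _
  -- Passing from `m` to `m + 1` gains the summable factor `j^{-2}`.
  have hle : ∀ ξ ∈ B, ∀ j : ℕ+, ‖ξ.val j‖ ^ 2 * ((j : ℕ) : ℝ) ^ (2 * (-(m + 1 : ℕ) : ℤ)) ≤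
      (m : ℝ) ^ 2 * (((j : ℕ) : ℝ) ^ 2)⁻¹ := by
    intro ξ hξ j
    have hj := pnat_cast_pos j
    have h1 := pow_le_pow_left₀ (norm_nonneg _) (hm ξ hξ j) 2
    refine (mul_le_mul_of_nonneg_right h1 (by positivity)).trans (le_of_eq ?_)
    rw [mul_pow, mul_assoc]
    congr 1
    rw [← pow_mul, ← zpow_natCast, ← zpow_add₀ hj.ne', ← zpow_natCast, ← zpow_neg]
    congr 1
    push_cast
    ring
  refine ⟨m + 1, √(∑' j : ℕ+, (m : ℝ) ^ 2 * (((j : ℕ) : ℝ) ^ 2)⁻¹) + 1,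
    add_pos_of_nonneg_of_pos (Real.sqrt_nonneg _) one_pos, fun ξ hξ => ?_⟩
  have hs : WSummable (-(m + 1 : ℕ)) ξ.val :=
    Summable.of_nonneg_of_le (w_term_nonneg _ _) (hle ξ hξ) hS
  refine ⟨hs, le_add_of_le_of_nonneg (Real.sqrt_le_sqrt ?_) zero_le_one⟩
  exact hs.tsum_le_tsum (hle ξ hξ) hS

theorem continuous_opSeminorm (n : ℕ) : Continuous (opSeminorm n) := by
  refine Seminorm.continuous_of_continuousAt_zero ?_
  rw [ContinuousAt, map_zero, Metric.nhds_basis_closedBall.tendsto_right_iff]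
  intro ε hε
  have hW : {ξ : RapidSeq | rapidNorm n ξ < ε} ∈ 𝓝 (0 : RapidSeq) :=
    (rapid_withSeminorms.continuous_seminorm n).continuousAt.eventually_lt continuousAt_const
      (by rw [map_zero]; exact hε)
  filter_upwards [(ContinuousLinearMap.hasBasis_nhds_zero_of_basis (σ := RingHom.id ℂ)
    (𝓝 (0 : RapidSeq)).basis_sets).mem_of_mem (i := (polarBall n, {ξ | rapidNorm n ξ < ε}))
    ⟨isVonNBounded_polarBall n, hW⟩] with x hx
  rw [Metric.mem_closedBall, dist_zero_right, opSeminorm_apply, Real.norm_of_nonneg (opNorm_nonneg _ _)]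
  exact opNorm_le fun η hη => (hx η hη).le

/-- With `continuous_opSeminorm`, this shows that the norms `‖·‖ₙ` define the topology of `𝒮`. One
index serves as both domain and target weight because `Uₙ°` and `|·|ₙ` increase with `n`. -/
theorem exists_opNorm_lt_subset {V : Set SchwartzOp} (hV : V ∈ 𝓝 (0 : SchwartzOp)) :
    ∃ (n : ℕ) (δ : ℝ), 0 < δ ∧ ∀ x : SchwartzOp, opNorm n x < δ → x ∈ V := by
  obtain ⟨⟨B, s, r⟩, ⟨hB, hr⟩, hsub⟩ := (ContinuousLinearMap.hasBasis_nhds_zero_of_basis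
    (σ := RingHom.id ℂ) (E := SlowSeq) rapid_withSeminorms.hasBasis_zero_ball).mem_iff.1 hV
  obtain ⟨m, C, hC, hBC⟩ := exists_wNorm_bound hB
  refine ⟨max m (s.sup id), r / C, by positivity, fun x hx => hsub fun η hη => ?_⟩
  rw [Seminorm.mem_ball_zero]
  refine Seminorm.finset_sup_apply_lt hr fun i hi => ?_
  obtain ⟨h1, h2⟩ := hBC η hη
  have hi' : i ≤ max m (s.sup id) := (Finset.le_sup (f := id) hi).trans (le_max_right _ _)
  have h3 : ((C⁻¹ : ℝ) : ℂ) • η ∈ polarBall (max m (s.sup id)) := by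
    refine polarBall_mono (le_max_left _ _) (smul_mem_polarBall h1 ?_)
    rw [Complex.norm_real, Real.norm_of_nonneg (by positivity), inv_mul_le_one₀ hC]
    exact h2
  have h4 := (rapidNorm_mono hi' _).trans (rapidNorm_le_opNorm x h3)
  rw [map_smul, map_smul_eq_mul, Complex.norm_real, Real.norm_of_nonneg (by positivity),
    inv_mul_le_iff₀ hC] at h4
  rw [lt_div_iff₀ hC] at hx
  linarith

theorem continuous_star_schwartzOp : Continuous fun x : SchwartzOp => star x := by
  let f : SchwartzOp →+ SchwartzOp := AddMonoidHom.mk' (fun x => star x) star_add'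
  refine continuous_of_continuousAt_zero f ?_
  rw [ContinuousAt, map_zero]
  intro V hV
  obtain ⟨n, δ, hδ, h⟩ := exists_opNorm_lt_subset hV
  have hU : {x : SchwartzOp | opSeminorm n x < δ} ∈ 𝓝 (0 : SchwartzOp) :=
    (continuous_opSeminorm n).continuousAt.eventually_lt continuousAt_const
      (by rw [map_zero]; exact hδ)
  refine Filter.mem_map.2 ?_
  filter_upwards [hU] with x hx
  refine h _ ?_
  show opNorm n (star x) < δ
  rw [opNorm_star]
  exact hx

/-- A bilinear form dominated by continuous seminorms is continuous. -/
theorem continuous_bilinear_of_seminorm_bound {E F : Type*} [AddCommGroup E] [Module ℂ E]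
    [TopologicalSpace E] [IsTopologicalAddGroup E] [AddCommGroup F] [Module ℂ F]
    [TopologicalSpace F] [IsTopologicalAddGroup F] (u : E →ₗ[ℂ] F →ₗ[ℂ] ℂ)
    {p : E → ℝ} {q : F → ℝ} (hp : Continuous p) (hq : Continuous q) (hp0 : p 0 = 0) (hq0 : q 0 = 0)
    (h : ∀ x y, ‖u x y‖ ≤ p x * q y) : Continuous fun z : E × F => u z.1 z.2 := by
  rw [continuous_iff_continuousAt]
  rintro ⟨a, b⟩
  rw [ContinuousAt, tendsto_iff_norm_sub_tendsto_zero]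
  have hlim : Filter.Tendsto (fun z : E × F => p (z.1 - a) * q (z.2 - b) + p (z.1 - a) * q b +
      p a * q (z.2 - b)) (𝓝 (a, b)) (𝓝 0) := by
    have hc : Continuous fun z : E × F => p (z.1 - a) * q (z.2 - b) + p (z.1 - a) * q b +
      p a * q (z.2 - b) := by fun_prop
    simpa [hp0, hq0] using hc.tendsto (a, b)
  refine squeeze_zero (fun _ => norm_nonneg _) (fun z => ?_) hlim
  have e : u z.1 z.2 - u a b = u (z.1 - a) (z.2 - b) + u (z.1 - a) b + u a (z.2 - b) := by
    simp only [map_sub, LinearMap.sub_apply]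
    ring
  rw [e]
  exact (norm_add₃_le).trans (add_le_add_three (h _ _) (h _ _) (h _ _))

/-! ### The constants `Kₙ` -/

/-- The rank-one operator `η ↦ η₁ e₁`. -/
def rankOne : SchwartzOp where
  toFun η := toDualₗ η (rapidBasis 1) • rapidBasis 1
  map_add' η ξ := by rw [map_add, add_apply, add_smul]
  map_smul' c η := by rw [map_smul, smul_apply, smul_assoc, RingHom.id_apply]
  cont := by
    have h : Continuous fun η : SlowSeq => toDualₗ η (rapidBasis 1) :=
      (continuous_eval_const (rapidBasis 1)).comp continuous_induced_dom
    exact h.smul continuous_const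

theorem rankOne_pairing : pairing (rankOne (slowBasis 1)) (slowBasis 1) = 1 := by
  have h : rankOne (slowBasis 1) = toDual (slowBasis 1) (rapidBasis 1) • rapidBasis 1 := rfl
  rw [h, pairing_smul_left, toDual_apply, pairing_slowBasis, rapidBasis_val]
  simp [slowBasis, slowOfFinset_val]

/-- The bilinear form `(x, y) ↦ ⟨x e₁, e₁⟩ ⟨y e₁, e₁⟩`. -/
def cornerForm : SchwartzOp →ₗ[ℂ] SchwartzOp →ₗ[ℂ] ℂ :=
  (LinearMap.mul ℂ ℂ).compl₁₂ (vectorFunctional (slowBasis 1)).toLinearMap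
    (vectorFunctional (slowBasis 1)).toLinearMap

theorem cornerForm_apply (x y : SchwartzOp) :
    cornerForm x y = pairing (x (slowBasis 1)) (slowBasis 1) *
      pairing (y (slowBasis 1)) (slowBasis 1) := rfl

theorem slowBasis_one_mem_polarBall (n : ℕ) : slowBasis 1 ∈ polarBall n :=
  ⟨wSummable_slowBasis _ _, by rw [wNorm_slowBasis]; simp⟩

theorem bilinNorm_cornerForm_le (n : ℕ) : bilinNorm n cornerForm ≤ 1 := by
  refine iSup₂_le fun x hx => iSup₂_le fun y hy => ?_
  rw [cornerForm_apply, ← ofReal_norm, norm_mul, ENNReal.ofReal_le_one]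
  have h := slowBasis_one_mem_polarBall n
  exact mul_le_one₀ ((norm_pairing_apply_le x h h).trans hx) (norm_nonneg _)
    ((norm_pairing_apply_le y h h).trans hy)

/-- For a finite factor `a`, the constants `C` with `‖∑ u(xⱼ, yⱼ)‖ ≤ C a` form a closed set, so it
contains the infimum. Multiplication by `⊤` would not be continuous. -/
theorem grothendieckConst_spec_of_ne_top (n : ℕ) (u : SchwartzOp →ₗ[ℂ] SchwartzOp →ₗ[ℂ] ℂ)
    (hu : Continuous fun p : SchwartzOp × SchwartzOp => u p.1 p.2) (hb : bilinNorm n u ≠ ⊤)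
    {m : ℕ} (x y : Fin m → SchwartzOp) :
    ‖∑ j, u (x j) (y j)‖ₑ ≤ grothendieckConst n * bilinNorm n u *
      ENNReal.ofReal (rcNorm (2 * n + 1) x) * ENNReal.ofReal (rcNorm (2 * n + 1) y) := by
  set a := bilinNorm n u * ENNReal.ofReal (rcNorm (2 * n + 1) x) *
    ENNReal.ofReal (rcNorm (2 * n + 1) y) with ha
  have hat : a ≠ ⊤ :=
    ENNReal.mul_ne_top (ENNReal.mul_ne_top hb ENNReal.ofReal_ne_top) ENNReal.ofReal_ne_top
  have hclosed : IsClosed {C : ℝ≥0∞ | ‖∑ j, u (x j) (y j)‖ₑ ≤ C * a} :=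
    isClosed_le continuous_const (ENNReal.continuous_mul_const hat)
  have hmem : grothendieckConst n ∈ {C : ℝ≥0∞ | ‖∑ j, u (x j) (y j)‖ₑ ≤ C * a} := by
    refine closure_minimal (fun C hC => ?_) hclosed (csInf_mem_closure
      ⟨_, fun v _ _ x y => grothendieck_inequality n v x y⟩ (OrderBot.bddBelow _))
    have h := hC u hu m x y
    simpa only [Set.mem_ofPred_eq, ha, mul_assoc] using h
  simpa only [Set.mem_ofPred_eq, ha, mul_assoc] using hmem

/-- Needed for forms of infinite norm: with `Kₙ = 0` the bound `Kₙ · ∞` would be `0`. -/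
theorem grothendieckConst_ne_zero (n : ℕ) : grothendieckConst n ≠ 0 := by
  intro h0
  have hc : Continuous fun p : SchwartzOp × SchwartzOp => cornerForm p.1 p.2 :=
    ((vectorFunctional (slowBasis 1)).continuous.comp continuous_fst).mul
      ((vectorFunctional (slowBasis 1)).continuous.comp continuous_snd)
  have h := grothendieckConst_spec_of_ne_top n cornerForm hc
    (ne_top_of_le_ne_top ENNReal.one_ne_top (bilinNorm_cornerForm_le n))
    (fun _ : Fin 1 => rankOne) (fun _ => rankOne)
  simp [h0, cornerForm_apply, rankOne_pairing] at h

/-- The infimum defining `Kₙ` is attained. -/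
theorem grothendieckConst_spec (n : ℕ) (u : SchwartzOp →ₗ[ℂ] SchwartzOp →ₗ[ℂ] ℂ)
    (hu : Continuous fun p : SchwartzOp × SchwartzOp => u p.1 p.2) {m : ℕ}
    (x y : Fin m → SchwartzOp) :
    ‖∑ j, u (x j) (y j)‖ₑ ≤ grothendieckConst n * bilinNorm n u *
      ENNReal.ofReal (rcNorm (2 * n + 1) x) * ENNReal.ofReal (rcNorm (2 * n + 1) y) := by
  rcases eq_or_ne (bilinNorm n u) ⊤ with hb | hb
  -- Both nonzero constants `Kₙ` and `π²/6` give `⊤` after multiplication by `⊤`, so the two bounds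
  -- coincide.
  · have h := grothendieck_inequality n u x y
    rw [hb] at h ⊢
    rw [ENNReal.mul_top (grothendieckConst_ne_zero n)]
    rwa [ENNReal.mul_top (by simpa using by positivity)] at h
  · exact grothendieckConst_spec_of_ne_top n u hu hb x y

theorem grothendieckConst_le_grothendieckK {n : ℕ} (hn : 1 ≤ n) :
    grothendieckConst n ≤ grothendieckK :=
  le_iSup₂_of_le n hn le_rfl

/-! ### The inequality for maps into Fréchet–Hilbert spaces -/

section Hilbert

variable {H : Type*} [AddCommGroup H] [Module ℂ H]

theorem core_add_right (c : PreInnerProductSpace.Core ℂ H) (a b d : H) :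
    c.inner a (b + d) = c.inner a b + c.inner a d :=
  @InnerProductSpace.Core.inner_add_right ℂ H _ _ _ c a b d

theorem core_smul_right (c : PreInnerProductSpace.Core ℂ H) (a b : H) (r : ℂ) :
    c.inner a (r • b) = r * c.inner a b :=
  @InnerProductSpace.Core.inner_smul_right ℂ H _ _ _ c a b r

theorem norm_core_inner_le (c : PreInnerProductSpace.Core ℂ H) (a b : H) :
    ‖c.inner a b‖ ≤ hilbertSeminorm c a * hilbertSeminorm c b :=
  @InnerProductSpace.Core.norm_inner_le_norm ℂ H _ _ _ c a b

variable [TopologicalSpace H]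

/-- The bilinear form `(x, y) ↦ ⟨u₁ x, u₂ y*⟩`. -/
def innerForm (c : PreInnerProductSpace.Core ℂ H) (u₁ u₂ : SchwartzOp →L[ℂ] H) :
    SchwartzOp →ₗ[ℂ] SchwartzOp →ₗ[ℂ] ℂ :=
  LinearMap.mk₂ ℂ (fun x y => c.inner (u₂ (star y)) (u₁ x))
    (fun x x' y => by rw [map_add, core_add_right])
    (fun r x y => by rw [map_smul, core_smul_right, smul_eq_mul])
    (fun x y y' => by rw [star_add', map_add, c.add_left])
    (fun r x y => by rw [star_smul', map_smul, c.smul_left, Complex.conj_conj, smul_eq_mul])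

theorem innerForm_apply (c : PreInnerProductSpace.Core ℂ H) (u₁ u₂ : SchwartzOp →L[ℂ] H)
    (x y : SchwartzOp) : innerForm c u₁ u₂ x y = c.inner (u₂ (star y)) (u₁ x) := rfl

theorem le_mapNorm {n : ℕ} (q : Seminorm ℂ H) (T : SchwartzOp →L[ℂ] H) {x : SchwartzOp}
    (hx : opNorm n x ≤ 1) : ENNReal.ofReal (q (T x)) ≤ mapNorm n q T :=
  le_iSup₂_of_le x hx le_rfl

theorem bilinNorm_innerForm_le (n : ℕ) (c : PreInnerProductSpace.Core ℂ H)
    (u₁ u₂ : SchwartzOp →L[ℂ] H) :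
    bilinNorm n (innerForm c u₁ u₂) ≤
      mapNorm n (hilbertSeminorm c) u₁ * mapNorm n (hilbertSeminorm c) u₂ := by
  refine iSup₂_le fun x hx => iSup₂_le fun y hy => ?_
  rw [innerForm_apply, ← ofReal_norm, mul_comm]
  refine (ENNReal.ofReal_le_ofReal (norm_core_inner_le c _ _)).trans ?_
  rw [ENNReal.ofReal_mul (apply_nonneg _ _)]
  exact mul_le_mul' (le_mapNorm _ _ (by rwa [opNorm_star])) (le_mapNorm _ _ hx)

theorem continuous_innerForm {c : PreInnerProductSpace.Core ℂ H}
    (hc : Continuous (hilbertSeminorm c)) (u₁ u₂ : SchwartzOp →L[ℂ] H) :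
    Continuous fun p : SchwartzOp × SchwartzOp => innerForm c u₁ u₂ p.1 p.2 := by
  refine continuous_bilinear_of_seminorm_bound (p := fun x => hilbertSeminorm c (u₁ x))
    (q := fun y => hilbertSeminorm c (u₂ (star y))) _ (hc.comp u₁.continuous)
    (hc.comp (u₂.continuous.comp continuous_star_schwartzOp)) (by simp) ?_ fun x y => ?_
  · have : star (0 : SchwartzOp) = 0 := by simpa using star_smul' 0 0
    rw [this, map_zero, map_zero]
  · rw [innerForm_apply, mul_comm]
    exact norm_core_inner_le c _ _

/-- Replacing `yⱼ` by `yⱼ*` undoes the involution that made `innerForm` bilinear. -/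
theorem enorm_sum_inner_le {c : PreInnerProductSpace.Core ℂ H}
    (hc : Continuous (hilbertSeminorm c)) (u₁ u₂ : SchwartzOp →L[ℂ] H) {n : ℕ} (hn : 1 ≤ n)
    {m : ℕ} (x y : Fin m → SchwartzOp) :
    ‖∑ j, c.inner (u₂ (y j)) (u₁ (x j))‖ₑ ≤
      grothendieckK * mapNorm n (hilbertSeminorm c) u₁ * mapNorm n (hilbertSeminorm c) u₂ *
        ENNReal.ofReal (rcNorm (2 * n + 1) x) * ENNReal.ofReal (rcNorm (2 * n + 1) y) := by
  have h := grothendieckConst_spec n (innerForm c u₁ u₂) (continuous_innerForm hc u₁ u₂) x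
    fun j => star (y j)
  simp only [innerForm_apply, star_star', rcNorm_star] at h
  refine h.trans ?_
  rw [mul_assoc grothendieckK]
  gcongr
  · exact grothendieckConst_le_grothendieckK hn
  · exact bilinNorm_innerForm_le n c u₁ u₂

end Hilbert

/-! ### Two tools from functional analysis -/

/-- Banach–Alaoglu: the functionals dominated by a given function form a weak-* compact set, as soon
as this function tends to `0` at `0`. -/
theorem isCompact_dominated {E : Type*} [AddCommGroup E] [Module ℂ E] [TopologicalSpace E]
    [IsTopologicalAddGroup E] [ContinuousConstSMul ℂ E] {p : E → ℝ} (hp : Continuous p)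
    (hp0 : p 0 = 0) : IsCompact {φ : WeakDual ℂ E | ∀ x, ‖φ x‖ ≤ p x} := by
  have hemb : Topology.IsEmbedding fun φ : WeakDual ℂ E => (φ : E → ℂ) :=
    DFunLike.coe_injective.isEmbedding_induced
  rw [hemb.isCompact_iff]
  -- The domination by `p` makes every linear function in the product of discs continuous, so the
  -- image is exactly a closed subset of a compact product.
  have himg : (fun φ : WeakDual ℂ E => (φ : E → ℂ)) '' {φ | ∀ x, ‖φ x‖ ≤ p x} =
      ({f : E → ℂ | ∀ x y, f (x + y) = f x + f y} ∩ {f | ∀ (c : ℂ) x, f (c • x) = c * f x}) ∩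
        Set.pi Set.univ fun x => Metric.closedBall 0 (p x) := by
    ext f
    constructor
    · rintro ⟨φ, hφ, rfl⟩
      exact ⟨⟨fun x y => map_add φ x y, fun c x => map_smul φ c x⟩,
        fun x _ => mem_closedBall_zero_iff.2 (hφ x)⟩
    · rintro ⟨⟨hadd, hsmul⟩, hf⟩
      have hb : ∀ x, ‖f x‖ ≤ p x := fun x => mem_closedBall_zero_iff.1 (hf x trivial)
      let g : E →ₗ[ℂ] ℂ := { toFun := f, map_add' := hadd, map_smul' := hsmul }
      have hg : Continuous g := by
        refine continuous_of_continuousAt_zero g ?_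
        rw [ContinuousAt, map_zero]
        have := hp.tendsto 0
        rw [hp0] at this
        exact squeeze_zero_norm hb this
      exact ⟨StrongDual.toWeakDual ⟨g, hg⟩, hb, rfl⟩
  rw [himg]
  refine (isCompact_univ_pi fun x => isCompact_closedBall _ _).inter_left (IsClosed.inter ?_ ?_)
  · simp only [Set.ofPred_forall]
    exact isClosed_iInter fun x => isClosed_iInter fun y =>
      isClosed_eq (continuous_apply _) (by fun_prop)
  · simp only [Set.ofPred_forall]
    exact isClosed_iInter fun c => isClosed_iInter fun x =>
      isClosed_eq (continuous_apply _) (continuous_const.mul (continuous_apply _))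

/-- A minimax principle: if every nonnegative combination of a family of affine functions takes
values `≥ -ε` on a compact convex set, then the functions are simultaneously nonnegative somewhere
on this set. -/
theorem exists_forall_nonneg_of_affine {E ι : Type*} [AddCommGroup E] [Module ℝ E]
    [TopologicalSpace E] {Q : Set E} (hQ : IsCompact Q) (hconv : Convex ℝ Q)
    (f : ι → E → ℝ) (hf : ∀ i, Continuous (f i))
    (haff : ∀ i a b, ∀ s t : ℝ, s + t = 1 → f i (s • a + t • b) = s * f i a + t * f i b)
    (h : ∀ (S : Finset ι) (w : S → ℝ), (∀ i, 0 ≤ w i) → ∀ ε > 0,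
      ∃ a ∈ Q, -ε ≤ ∑ i, w i * f i a) :
    ∃ a ∈ Q, ∀ i, 0 ≤ f i a := by
  have key := hQ.inter_iInter_nonempty (fun i => {a | 0 ≤ f i a})
    -- By the finite intersection property, finitely many functions suffice.
    (fun i => isClosed_le continuous_const (hf i)) fun S => ?_
  · obtain ⟨a, haQ, ha⟩ := key
    exact ⟨a, haQ, fun i => Set.mem_iInter.1 ha i⟩
  by_contra hne
  let g : E → S → ℝ := fun a i => f i a
  have hgc : Continuous g := continuous_pi fun i => hf i
  have himg : Convex ℝ (g '' Q) := by
    rintro _ ⟨a, ha, rfl⟩ _ ⟨b, hb, rfl⟩ s t hs ht hst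
    exact ⟨s • a + t • b, hconv ha hb hs ht hst, funext fun i => haff i a b s t hst⟩
  have hCconv : Convex ℝ {v : S → ℝ | ∀ i, 0 ≤ v i} := fun v hv w hw s t hs ht _ i =>
    add_nonneg (mul_nonneg hs (hv i)) (mul_nonneg ht (hw i))
  have hCclosed : IsClosed {v : S → ℝ | ∀ i, 0 ≤ v i} := by
    simp only [Set.ofPred_forall]
    exact isClosed_iInter fun i => isClosed_le continuous_const (continuous_apply i)
  have hdisj : Disjoint (g '' Q) {v : S → ℝ | ∀ i, 0 ≤ v i} := by
    rw [Set.disjoint_left]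
    rintro _ ⟨a, ha, rfl⟩ hv
    exact hne ⟨a, ha, Set.mem_iInter₂.2 fun i hi => hv ⟨i, hi⟩⟩
  -- The functional `L` separates the image of `Q` from the positive orthant; its coefficients
  -- become the weights.
  obtain ⟨L, u, v, hu, huv, hv⟩ := geometric_hahn_banach_compact_closed himg (hQ.image hgc) hCconv
    hCclosed hdisj
  have hv0 : v < 0 := by simpa using hv 0 fun i => le_rfl
  classical
  have hL : ∀ x : S → ℝ, L x = ∑ i, L (Pi.single i 1) * x i := by
    intro x
    conv_lhs => rw [pi_eq_sum_univ' x]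
    rw [map_sum]
    refine Finset.sum_congr rfl fun i _ => ?_
    rw [map_smul, smul_eq_mul, mul_comm]
  have hw : ∀ i, 0 ≤ L (Pi.single i 1) := by
    intro i
    by_contra! hneg
    -- A negative coefficient would let this point of the orthant attain the value `v`, which is
    -- excluded.
    have := hv ((v / L (Pi.single i 1)) • Pi.single i 1) fun j => by
      refine mul_nonneg (div_nonneg_of_nonpos hv0.le hneg.le) ?_
      by_cases hij : j = i
      · subst hij; simp
      · simp [hij]
    rw [map_smul, smul_eq_mul, div_mul_cancel₀ _ hneg.ne] at this
    exact lt_irrefl _ this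
  -- With `ε = -v` some point of `Q` has `L`-value at least `v`, whereas separation forces values
  -- below `u < v`.
  obtain ⟨a, ha, hε⟩ := h S (fun i => L (Pi.single i 1)) hw (-v) (by linarith)
  have := hu _ ⟨a, ha, rfl⟩
  rw [hL] at this
  linarith

/-! ### States -/

theorem weakDual_smul_apply (t : ℝ) (φ : WeakDual ℂ SchwartzOp) (x : SchwartzOp) :
    (t • φ) x = (t : ℂ) * φ x := rfl

theorem weakDual_add_apply (φ ψ : WeakDual ℂ SchwartzOp) (x : SchwartzOp) :
    (φ + ψ) x = φ x + ψ x := rfl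

theorem convex_nStates (n : ℕ) : Convex ℝ (nStates n) := (convex_convexHull ℝ _).closure

theorem vectorFunctional_mem_nStates {n : ℕ} {ξ : SlowSeq} (hξ : ξ ∈ polarBall n) :
    StrongDual.toWeakDual (vectorFunctional ξ) ∈ nStates n :=
  subset_closure (subset_convexHull ℝ _ ⟨ξ, hξ, rfl⟩)

theorem nStates_subset {n : ℕ} {S : Set (WeakDual ℂ SchwartzOp)} (hc : IsClosed S)
    (hconv : Convex ℝ S)
    (h : ∀ ξ ∈ polarBall n, StrongDual.toWeakDual (vectorFunctional ξ) ∈ S) : nStates n ⊆ S :=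
  closure_minimal (convexHull_min (by rintro _ ⟨ξ, hξ, rfl⟩; exact h ξ hξ) hconv) hc

theorem continuous_weakDual_eval (x : SchwartzOp) :
    Continuous fun φ : WeakDual ℂ SchwartzOp => φ x := WeakDual.eval_continuous x

theorem norm_nState_apply_le {n : ℕ} {φ : WeakDual ℂ SchwartzOp} (hφ : φ ∈ nStates n)
    (x : SchwartzOp) : ‖φ x‖ ≤ opNorm n x := by
  refine nStates_subset (S := {φ | ‖φ x‖ ≤ opNorm n x})
    (isClosed_le (continuous_weakDual_eval x).norm continuous_const) ?_
    (fun ξ hξ => norm_pairing_apply_le x hξ hξ) hφ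
  intro φ hφ ψ hψ s t hs ht hst
  have hφ' : ‖φ x‖ ≤ opNorm n x := hφ
  have hψ' : ‖ψ x‖ ≤ opNorm n x := hψ
  rw [Set.mem_ofPred_eq, weakDual_add_apply, weakDual_smul_apply, weakDual_smul_apply]
  refine (norm_add_le _ _).trans ?_
  rw [norm_mul, norm_mul, Complex.norm_real, Complex.norm_real, Real.norm_of_nonneg hs,
    Real.norm_of_nonneg ht]
  calc s * ‖φ x‖ + t * ‖ψ x‖ ≤ s * opNorm n x + t * opNorm n x := by gcongr
    _ = opNorm n x := by rw [← add_mul, hst, one_mul]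

/-- A weak-* closed subset of the functionals dominated by the continuous seminorm `‖·‖ₙ`. -/
theorem isCompact_nStates (n : ℕ) : IsCompact (nStates n) :=
  (isCompact_dominated (continuous_opSeminorm n) (map_zero _)).of_isClosed_subset isClosed_closure
    fun _ hφ x => norm_nState_apply_le hφ x

theorem vectorFunctional_star_mul (ξ : SlowSeq) (x : SchwartzOp) :
    vectorFunctional ξ (star x * x) = ((rapidNorm 0 (x ξ) ^ 2 : ℝ) : ℂ) := by
  rw [← rapidNorm_zero_sq, ← pairing_star_mul]
  rfl

theorem re_nState_star_mul_nonneg {n : ℕ} {φ : WeakDual ℂ SchwartzOp} (hφ : φ ∈ nStates n)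
    (x : SchwartzOp) : 0 ≤ (φ (star x * x)).re := by
  refine nStates_subset (S := {φ | 0 ≤ (φ (star x * x)).re})
    (isClosed_le continuous_const (Complex.continuous_re.comp (continuous_weakDual_eval _))) ?_
    (fun ξ hξ => ?_) hφ
  · intro φ hφ ψ hψ s t hs ht _
    have hφ' : 0 ≤ (φ (star x * x)).re := hφ
    have hψ' : 0 ≤ (ψ (star x * x)).re := hψ
    rw [Set.mem_ofPred_eq, weakDual_add_apply, weakDual_smul_apply, weakDual_smul_apply,
      Complex.add_re, Complex.re_ofReal_mul, Complex.re_ofReal_mul]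
    positivity
  · change 0 ≤ (vectorFunctional ξ (star x * x)).re
    rw [vectorFunctional_star_mul, Complex.ofReal_re]
    positivity

theorem re_nState_mul_star_nonneg {n : ℕ} {φ : WeakDual ℂ SchwartzOp} (hφ : φ ∈ nStates n)
    (x : SchwartzOp) : 0 ≤ (φ (x * star x)).re := by
  simpa only [star_star'] using re_nState_star_mul_nonneg hφ (star x)

/-- The norm of a positive element is the supremum of its values at states. -/
theorem exists_nState_sum_star_mul (n : ℕ) {m : ℕ} (x : Fin m → SchwartzOp) {ε : ℝ} (hε : 0 < ε) :
    ∃ φ ∈ nStates n, opNorm n (∑ j, star (x j) * x j) - ε ≤ ∑ j, (φ (star (x j) * x j)).re := by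
  by_contra! hcon
  have h : ∀ η ∈ polarBall n,
      ∑ j, rapidNorm 0 (x j η) ^ 2 ≤ opNorm n (∑ j, star (x j) * x j) - ε := by
    intro η hη
    have h1 := hcon _ (vectorFunctional_mem_nStates hη)
    refine le_trans (le_of_eq (Finset.sum_congr rfl fun j _ => ?_)) h1.le
    change _ = (vectorFunctional η (star (x j) * x j)).re
    rw [vectorFunctional_star_mul, Complex.ofReal_re]
  linarith [opNorm_sum_star_mul_le x h]

theorem exists_nStates_rcNorm (n : ℕ) {m : ℕ} (x : Fin m → SchwartzOp) {ε : ℝ} (hε : 0 < ε) :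
    ∃ φ₁ ∈ nStates n, ∃ φ₂ ∈ nStates n,
      rcNorm n x ^ 2 - ε ≤
        ∑ j, ((φ₁ (star (x j) * x j)).re + (φ₂ (x j * star (x j))).re) := by
  obtain ⟨φ₁, h₁, hx₁⟩ := exists_nState_sum_star_mul n x hε
  obtain ⟨φ₂, h₂, hx₂⟩ := exists_nState_sum_star_mul n (fun j => star (x j)) hε
  simp only [star_star'] at hx₂
  refine ⟨φ₁, h₁, φ₂, h₂, ?_⟩
  rw [Finset.sum_add_distrib]
  have p₁ := Finset.sum_nonneg fun j (_ : j ∈ Finset.univ) => re_nState_star_mul_nonneg h₁ (x j)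
  have p₂ := Finset.sum_nonneg fun j (_ : j ∈ Finset.univ) => re_nState_mul_star_nonneg h₂ (x j)
  -- One state attains the larger of the two norms up to `ε`; the other contributes a nonnegative
  -- sum.
  rcases max_choice √(opNorm n (∑ j, star (x j) * x j)) √(opNorm n (∑ j, x j * star (x j))) with
    h | h
  · rw [rcNorm, h, Real.sq_sqrt (opNorm_nonneg _ _)]
    linarith
  · rw [rcNorm, h, Real.sq_sqrt (opNorm_nonneg _ _)]
    linarith

/-- The partial sums of `∑_q 2^{-q-1} φ_q` lie in a convex set containing `0` and all `φ_q`. -/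
theorem Convex.sum_geometric_mem {E : Type*} [AddCommGroup E] [Module ℝ E] {Q : Set E}
    (hQ : Convex ℝ Q) (h0 : (0 : E) ∈ Q) (φ : ℕ → E) (hφ : ∀ q, φ q ∈ Q) (N : ℕ) :
    ∑ q ∈ Finset.range N, ((1 / 2 : ℝ) ^ (q + 1)) • φ q ∈ Q := by
  induction N generalizing φ with
  | zero => simpa using h0
  | succ N ih =>
    rw [Finset.sum_range_succ']
    -- The sum of length `N + 1` is the midpoint of `φ 0` and the sum of length `N` for the shifted
    -- sequence.
    have h := hQ (ih (fun q => φ (q + 1)) fun q => hφ (q + 1)) (hφ 0)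
      (by norm_num : (0 : ℝ) ≤ 1 / 2) (by norm_num : (0 : ℝ) ≤ 1 / 2) (by norm_num)
    rw [Finset.smul_sum] at h
    simpa only [smul_smul, pow_succ', zero_add, pow_zero, mul_one] using h

/-- There is a state which is faithful on positive elements. -/
theorem exists_faithful_nState (n : ℕ) :
    ∃ φ ∈ nStates n, ∀ x : SchwartzOp, (φ (star x * x)).re ≤ 0 → x = 0 := by
  -- This factor normalises `e_{q+1}` to have dual norm `1`.
  let c : ℕ → ℂ := fun q => ((((q.succPNat : ℕ) : ℝ) ^ (n : ℤ) : ℝ) : ℂ)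
  let η : ℕ → SlowSeq := fun q => c q • slowBasis q.succPNat
  have hc : ∀ q, ‖c q‖ = ((q.succPNat : ℕ) : ℝ) ^ (n : ℤ) := fun q => by
    rw [Complex.norm_real, Real.norm_of_nonneg (zpow_nonneg (pnat_cast_pos _).le _)]
  have hη : ∀ q, η q ∈ polarBall n := fun q => by
    refine smul_mem_polarBall (wSummable_slowBasis _ _) ?_
    rw [hc, wNorm_slowBasis, ← zpow_add₀ (pnat_cast_pos _).ne', add_neg_cancel, zpow_zero]
  let ψ : ℕ → WeakDual ℂ SchwartzOp := fun q => StrongDual.toWeakDual (vectorFunctional (η q))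
  have hψ : ∀ q, ψ q ∈ nStates n := fun q => vectorFunctional_mem_nStates (hη q)
  -- Zero is a state in this sense; it fills the mass missing from the partial geometric sums.
  have h0 : (0 : WeakDual ℂ SchwartzOp) ∈ nStates n := by
    convert! vectorFunctional_mem_nStates (zero_mem_polarBall n)
    refine (ContinuousLinearMap.ext fun x => ?_ : (0 : SchwartzOp →L[ℂ] ℂ) = vectorFunctional 0)
    change 0 = pairing (x 0) 0
    rw [map_zero, pairing_zero_left]
  -- Compactness gives a state dominating every `2^{-q-1} ψ q` on the elements `x* x`, so
  -- convergence of the series need not be discussed.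
  let P : ℕ → Set (WeakDual ℂ SchwartzOp) := fun q =>
    {φ | ∀ x : SchwartzOp, (1 / 2 : ℝ) ^ (q + 1) * (ψ q (star x * x)).re ≤ (φ (star x * x)).re}
  have hP : ∀ q, IsClosed (P q) := fun q => by
    simp only [P, Set.ofPred_forall]
    exact isClosed_iInter fun x => isClosed_le continuous_const
      (Complex.continuous_re.comp (continuous_weakDual_eval _))
  obtain ⟨φ, hφ, hφP⟩ := (isCompact_nStates n).inter_iInter_nonempty P hP fun S => by
    refine ⟨_, (convex_nStates n).sum_geometric_mem h0 ψ hψ (S.sup id + 1),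
      Set.mem_iInter₂.2 fun q hq x => ?_⟩
    have hsum : ∀ T : Finset ℕ, ((∑ i ∈ T, ((1 / 2 : ℝ) ^ (i + 1)) • ψ i :
        WeakDual ℂ SchwartzOp) (star x * x)).re =
        ∑ i ∈ T, (1 / 2 : ℝ) ^ (i + 1) * (ψ i (star x * x)).re := by
      intro T
      induction T using Finset.induction_on with
      | empty => rfl
      | insert a T ha ih =>
        rw [Finset.sum_insert ha, Finset.sum_insert ha, weakDual_add_apply, Complex.add_re, ih,
          weakDual_smul_apply, Complex.re_ofReal_mul]
    refine le_of_le_of_eq ?_ (hsum _).symm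
    refine Finset.single_le_sum (f := fun i => (1 / 2 : ℝ) ^ (i + 1) * (ψ i (star x * x)).re)
      (fun i _ => mul_nonneg (by positivity) (re_nState_star_mul_nonneg (hψ i) x)) ?_
    exact Finset.mem_range.2 (Nat.lt_succ_of_le (Finset.le_sup (f := id) hq))
  refine ⟨φ, hφ, fun x hx => ?_⟩
  have hz : ∀ q : ℕ, rapidNorm 0 (x (slowBasis q.succPNat)) = 0 := by
    intro q
    have h1 := Set.mem_iInter.1 hφP q x
    change (1 / 2 : ℝ) ^ (q + 1) * (vectorFunctional (η q) (star x * x)).re ≤ _ at h1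
    rw [vectorFunctional_star_mul, Complex.ofReal_re] at h1
    have h2 : rapidNorm 0 (x (η q)) = 0 := by
      by_contra hne
      have : 0 < (1 / 2 : ℝ) ^ (q + 1) * rapidNorm 0 (x (η q)) ^ 2 := by positivity
      linarith
    rw [map_smul, map_smul_eq_mul, hc] at h2
    exact (mul_eq_zero.1 h2).resolve_left (zpow_pos (pnat_cast_pos _) _).ne'
  refine eq_zero_of_opNorm_eq_zero (n := 0) (le_antisymm ?_ (opNorm_nonneg _ _))
  have hval : ∀ p q : ℕ+, (x (slowBasis q)).val p = 0 := by
    intro p q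
    have h1 := norm_pairing_le (x (slowBasis q)) (slowBasis p) (wSummable_slowBasis (-(0 : ℕ)) p)
    have h2 := hz q.natPred
    rw [PNat.succPNat_natPred] at h2
    rw [h2, zero_mul, pairing_slowBasis, norm_le_zero_iff] at h1
    exact h1
  have h := ofReal_opNorm_sq_le_hsSq 0 x
  simp only [hsSq, hval, norm_zero, ne_eq, OfNat.ofNat_ne_zero, not_false_eq_true, zero_pow,
    zero_mul, ENNReal.ofReal_zero, tsum_zero, nonpos_iff_eq_zero, ENNReal.ofReal_eq_zero] at h
  nlinarith [opNorm_nonneg 0 x]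

/-! ### Domination by states -/

theorem re_apply_star_smul_mul_smul (φ : WeakDual ℂ SchwartzOp) (c : ℂ) (x : SchwartzOp) :
    (φ (star (c • x) * (c • x))).re = ‖c‖ ^ 2 * (φ (star x * x)).re := by
  rw [star_smul_mul_smul, map_smul, smul_eq_mul, Complex.re_ofReal_mul]

theorem re_apply_smul_mul_star_smul (φ : WeakDual ℂ SchwartzOp) (c : ℂ) (x : SchwartzOp) :
    (φ ((c • x) * star (c • x))).re = ‖c‖ ^ 2 * (φ (x * star x)).re := by
  rw [smul_mul_star_smul, map_smul, smul_eq_mul, Complex.re_ofReal_mul]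

/-- A real quadratic polynomial in `s` that is nowhere negative has nonpositive discriminant. -/
theorem norm_le_of_forall_quadratic {α β c r : ℝ} (hα : 0 ≤ α) (hβ : 0 ≤ β) (hc : 0 ≤ c)
    (h : ∀ s : ℝ, 2 * s * r ≤ c * (s ^ 2 * α + β)) : r ≤ c * √α * √β := by
  have hd := discrim_le_zero (a := c * α) (b := -2 * r) (c := c * β) fun s => by
    have := h s
    nlinarith
  rw [discrim] at hd
  refine le_of_sq_le_sq ?_ (by positivity)
  rw [mul_pow, mul_pow, Real.sq_sqrt hα, Real.sq_sqrt hβ]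
  nlinarith

section Hilbert

variable {H : Type*} [AddCommGroup H] [Module ℂ H] [TopologicalSpace H]

/-- The product of row/column norms is not affine in the states, but `2ab ≤ a² + b²` replaces it by
a sum of squares that is, and the minimax principle applies. -/
theorem exists_nStates_quadratic_bound (ip : PreInnerProductSpace.Core ℂ H)
    (u₁ u₂ : SchwartzOp →L[ℂ] H) (k : ℕ) {c : ℝ} (hc : 0 ≤ c)
    (h : ∀ (m : ℕ) (x y : Fin m → SchwartzOp),
      ‖∑ j, ip.inner (u₂ (y j)) (u₁ (x j))‖ ≤ c * rcNorm k x * rcNorm k y) :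
    ∃ φ₁ ∈ nStates k, ∃ φ₂ ∈ nStates k, ∃ ψ₁ ∈ nStates k, ∃ ψ₂ ∈ nStates k,
      ∀ x y : SchwartzOp, 2 * (ip.inner (u₂ y) (u₁ x)).re ≤
        c * (((φ₁ (star x * x)).re + (φ₂ (x * star x)).re) +
          ((ψ₁ (star y * y)).re + (ψ₂ (y * star y)).re)) := by
  let D := WeakDual ℂ SchwartzOp
  let f : SchwartzOp × SchwartzOp → D × D × D × D → ℝ := fun z χ =>
    c * (((χ.1 (star z.1 * z.1)).re + (χ.2.1 (z.1 * star z.1)).re) +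
      ((χ.2.2.1 (star z.2 * z.2)).re + (χ.2.2.2 (z.2 * star z.2)).re)) -
      2 * (ip.inner (u₂ z.2) (u₁ z.1)).re
  have hev : ∀ a : SchwartzOp, Continuous fun φ : D => (φ a).re := fun a =>
    Complex.continuous_re.comp (continuous_weakDual_eval a)
  suffices key : ∃ χ ∈ nStates k ×ˢ nStates k ×ˢ nStates k ×ˢ nStates k, ∀ z, 0 ≤ f z χ by
    obtain ⟨⟨φ₁, φ₂, ψ₁, ψ₂⟩, ⟨h₁, h₂, h₃, h₄⟩, hχ⟩ := key
    exact ⟨φ₁, h₁, φ₂, h₂, ψ₁, h₃, ψ₂, h₄, fun x y => sub_nonneg.1 (hχ (x, y))⟩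
  refine exists_forall_nonneg_of_affine
    ((isCompact_nStates k).prod ((isCompact_nStates k).prod
      ((isCompact_nStates k).prod (isCompact_nStates k))))
    ((convex_nStates k).prod ((convex_nStates k).prod
      ((convex_nStates k).prod (convex_nStates k)))) f ?_ ?_ ?_
  · intro z
    exact (continuous_const.mul ((((hev _).comp continuous_fst).add
      ((hev _).comp (continuous_fst.comp continuous_snd))).add
      (((hev _).comp (continuous_fst.comp (continuous_snd.comp continuous_snd))).add
      ((hev _).comp (continuous_snd.comp (continuous_snd.comp continuous_snd)))))).sub
      continuous_const
  · intro z a b s t hst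
    have hlin : ∀ (φ ψ : D) (x : SchwartzOp),
        ((s • φ + t • ψ : D) x).re = s * (φ x).re + t * (ψ x).re := fun φ ψ x => by
      rw [weakDual_add_apply, weakDual_smul_apply, weakDual_smul_apply, Complex.add_re,
        Complex.re_ofReal_mul, Complex.re_ofReal_mul]
    simp only [f, Prod.fst_add, Prod.snd_add, Prod.smul_fst, Prod.smul_snd]
    erw [hlin, hlin, hlin, hlin]
    linear_combination 2 * (ip.inner (u₂ z.2) (u₁ z.1)).re * hst
  · intro S w hw ε hε
    let e := Fintype.equivFin S
    -- Both entries of a pair are scaled by the square root of its weight, so quadratic and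
    -- sesquilinear terms alike acquire the weight itself.
    let r : Fin (Fintype.card S) → ℂ := fun j => ((√(w (e.symm j)) : ℝ) : ℂ)
    have hr : ∀ j, ‖r j‖ ^ 2 = w (e.symm j) := fun j => by
      rw [Complex.norm_real, Real.norm_of_nonneg (Real.sqrt_nonneg _), Real.sq_sqrt (hw _)]
    let X : Fin (Fintype.card S) → SchwartzOp := fun j => r j • (e.symm j).1.1
    let Y : Fin (Fintype.card S) → SchwartzOp := fun j => r j • (e.symm j).1.2
    -- The errors of both families, multiplied by `c`, add up to at most `ε`; the `+ 1` covers `c =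
    -- 0`.
    have hδ : 0 < ε / (2 * (c + 1)) := by positivity
    obtain ⟨φ₁, h₁, φ₂, h₂, hX⟩ := exists_nStates_rcNorm k X hδ
    obtain ⟨ψ₁, h₃, ψ₂, h₄, hY⟩ := exists_nStates_rcNorm k Y hδ
    refine ⟨(φ₁, φ₂, ψ₁, ψ₂), ⟨h₁, h₂, h₃, h₄⟩, ?_⟩
    have hinner : ∀ j, (ip.inner (u₂ (Y j)) (u₁ (X j))).re =
        w (e.symm j) * (ip.inner (u₂ (e.symm j).1.2) (u₁ (e.symm j).1.1)).re := fun j => by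
      rw [map_smul, map_smul, core_smul_right, ip.smul_left, ← mul_assoc, mul_comm (r j),
        ← Complex.normSq_eq_conj_mul_self, Complex.normSq_eq_norm_sq, hr, Complex.re_ofReal_mul]
    have hsum : ∑ i, w i * f i (φ₁, φ₂, ψ₁, ψ₂) =
        c * (∑ j, ((φ₁ (star (X j) * X j)).re + (φ₂ (X j * star (X j))).re) +
          ∑ j, ((ψ₁ (star (Y j) * Y j)).re + (ψ₂ (Y j * star (Y j))).re)) -
        2 * (∑ j, ip.inner (u₂ (Y j)) (u₁ (X j))).re := by
      rw [← e.symm.sum_comp, ← Finset.sum_add_distrib, Finset.mul_sum, Complex.re_sum,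
        Finset.mul_sum, ← Finset.sum_sub_distrib]
      refine Finset.sum_congr rfl fun j _ => ?_
      rw [hinner, re_apply_star_smul_mul_smul, re_apply_smul_mul_star_smul,
        re_apply_star_smul_mul_smul, re_apply_smul_mul_star_smul, hr]
      simp only [f]
      ring
    rw [hsum]
    have h5 := (Complex.re_le_norm _).trans (h _ X Y)
    have h6 := mul_le_mul_of_nonneg_left (add_le_add hX hY) hc
    have h7 := mul_nonneg hc (sq_nonneg (rcNorm k X - rcNorm k Y))
    have h8 : c * (2 * (ε / (2 * (c + 1)))) ≤ ε := by
      have : c * (2 * (ε / (2 * (c + 1)))) = ε * (c / (c + 1)) := by field_simp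
      rw [this]
      exact mul_le_of_le_one_right hε.le ((div_le_one (by linarith)).2 (by linarith))
    nlinarith

theorem exists_nStates_bound (ip : PreInnerProductSpace.Core ℂ H)
    (u₁ u₂ : SchwartzOp →L[ℂ] H) (k : ℕ) {c : ℝ} (hc : 0 ≤ c)
    (h : ∀ (m : ℕ) (x y : Fin m → SchwartzOp),
      ‖∑ j, ip.inner (u₂ (y j)) (u₁ (x j))‖ ≤ c * rcNorm k x * rcNorm k y) :
    ∃ φ₁ ∈ nStates k, ∃ φ₂ ∈ nStates k, ∃ ψ₁ ∈ nStates k, ∃ ψ₂ ∈ nStates k,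
      ∀ x y : SchwartzOp, ‖ip.inner (u₂ y) (u₁ x)‖ ≤
        c * √((φ₁ (star x * x) + φ₂ (x * star x)).re) *
          √((ψ₁ (star y * y) + ψ₂ (y * star y)).re) := by
  obtain ⟨φ₁, h₁, φ₂, h₂, ψ₁, h₃, ψ₂, h₄, hχ⟩ := exists_nStates_quadratic_bound ip u₁ u₂ k hc h
  refine ⟨φ₁, h₁, φ₂, h₂, ψ₁, h₃, ψ₂, h₄, fun x y => ?_⟩
  rw [Complex.add_re, Complex.add_re]
  refine norm_le_of_forall_quadratic
    (add_nonneg (re_nState_star_mul_nonneg h₁ x) (re_nState_mul_star_nonneg h₂ x))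
    (add_nonneg (re_nState_star_mul_nonneg h₃ y) (re_nState_mul_star_nonneg h₄ y)) hc fun s => ?_
  obtain ⟨θ, hθ, hθz⟩ := RCLike.exists_norm_eq_mul_self (ip.inner (u₂ y) (u₁ x))
  -- The phase `θ` turns the real part into the modulus; the free real factor `s` recovers the
  -- product of square roots from their sum of squares.
  have hs := hχ (((s : ℂ) * θ) • x) y
  have hn : ‖(s : ℂ) * θ‖ ^ 2 = s ^ 2 := by
    rw [norm_mul, hθ, mul_one, Complex.norm_real, Real.norm_eq_abs, sq_abs]
  rw [re_apply_star_smul_mul_smul, re_apply_smul_mul_star_smul, hn, map_smul, core_smul_right,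
    mul_assoc, ← hθz, Complex.re_ofReal_mul] at hs
  change 2 * (s * ((‖ip.inner (u₂ y) (u₁ x)‖ : ℝ) : ℂ).re) ≤ _ at hs
  rw [Complex.ofReal_re] at hs
  linarith

theorem exists_nStates_enorm_inner_le {ip : PreInnerProductSpace.Core ℂ H}
    (hip : Continuous (hilbertSeminorm ip)) (u₁ u₂ : SchwartzOp →L[ℂ] H) {n : ℕ} (hn : 1 ≤ n) :
    ∃ φ₁ ∈ nStates (2 * n + 1), ∃ φ₂ ∈ nStates (2 * n + 1),
    ∃ ψ₁ ∈ nStates (2 * n + 1), ∃ ψ₂ ∈ nStates (2 * n + 1),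
      ∀ x y : SchwartzOp,
        ‖ip.inner (u₂ y) (u₁ x)‖ₑ ≤
          grothendieckK * mapNorm n (hilbertSeminorm ip) u₁ *
            mapNorm n (hilbertSeminorm ip) u₂ *
            ENNReal.ofReal √((φ₁ (star x * x) + φ₂ (x * star x)).re) *
            ENNReal.ofReal √((ψ₁ (star y * y) + ψ₂ (y * star y)).re) := by
  have hsum := fun (m : ℕ) (x y : Fin m → SchwartzOp) => enorm_sum_inner_le hip u₁ u₂ hn x y
  set A := grothendieckK * mapNorm n (hilbertSeminorm ip) u₁ * mapNorm n (hilbertSeminorm ip) u₂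
  rcases eq_or_ne A ⊤ with hA | hA
  -- For an infinite constant, faithfulness keeps the square roots nonzero for nonzero `x` and `y`,
  -- so the right side is `⊤` and not `∞ · 0 = 0`.
  · obtain ⟨φ, hφ, hfaith⟩ := exists_faithful_nState (2 * n + 1)
    refine ⟨φ, hφ, φ, hφ, φ, hφ, φ, hφ, fun x y => ?_⟩
    have hpos : ∀ z : SchwartzOp, z ≠ 0 →
        ENNReal.ofReal √((φ (star z * z) + φ (z * star z)).re) ≠ 0 := by
      intro z hz
      rw [ne_eq, ENNReal.ofReal_eq_zero, not_le, Real.sqrt_pos, Complex.add_re]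
      exact add_pos_of_pos_of_nonneg (not_le.1 fun h => hz (hfaith z h))
        (re_nState_mul_star_nonneg hφ z)
    rcases eq_or_ne x 0 with rfl | hx
    · have : ip.inner (u₂ y) (u₁ 0) = 0 := by
        simpa using core_smul_right ip (u₂ y) 0 0
      rw [this, enorm_zero]
      exact zero_le
    rcases eq_or_ne y 0 with rfl | hy
    · have : ip.inner (u₂ 0) (u₁ x) = 0 := by
        simpa using ip.smul_left 0 (u₁ x) 0
      rw [this, enorm_zero]
      exact zero_le
    rw [hA, ENNReal.top_mul (hpos x hx), ENNReal.top_mul (hpos y hy)]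
    exact le_top
  · obtain ⟨φ₁, h₁, φ₂, h₂, ψ₁, h₃, ψ₂, h₄, hχ⟩ := exists_nStates_bound ip u₁ u₂ (2 * n + 1)
      (c := A.toReal) ENNReal.toReal_nonneg fun m x y => by
        have h := hsum m x y
        rw [← ENNReal.ofReal_toReal hA, ← ENNReal.ofReal_mul ENNReal.toReal_nonneg,
          ← ENNReal.ofReal_mul (mul_nonneg ENNReal.toReal_nonneg (rcNorm_nonneg _ _)),
          ← ofReal_norm] at h
        exact (ENNReal.ofReal_le_ofReal_iff (mul_nonneg (mul_nonneg ENNReal.toReal_nonneg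
          (rcNorm_nonneg _ _)) (rcNorm_nonneg _ _))).1 h
    refine ⟨φ₁, h₁, φ₂, h₂, ψ₁, h₃, ψ₂, h₄, fun x y => ?_⟩
    rw [← ofReal_norm, ← ENNReal.ofReal_toReal hA, ← ENNReal.ofReal_mul ENNReal.toReal_nonneg,
      ← ENNReal.ofReal_mul (by positivity)]
    exact ENNReal.ofReal_le_ofReal (hχ x y)

end Hilbert

end NCSchwartz

end

theorem mainTheorem6 {H : Type*} [AddCommGroup H] [Module ℂ H] [UniformSpace H]
    [IsUniformAddGroup H] [ContinuousSMul ℂ H] [T2Space H] [CompleteSpace H]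
    (ip : ℕ → PreInnerProductSpace.Core ℂ H)
    (hip : WithSeminorms fun k => hilbertSeminorm (ip k))
    (u₁ u₂ : SchwartzOp →L[ℂ] H) :
    grothendieckK ≤ ENNReal.ofReal (Real.pi ^ 2 / 6) ∧
    (∀ (k n m : ℕ), 1 ≤ n → ∀ x y : Fin m → SchwartzOp,
      ‖∑ j, (ip k).inner (u₂ (y j)) (u₁ (x j))‖ₑ ≤
        grothendieckK * mapNorm n (hilbertSeminorm (ip k)) u₁ *
          mapNorm n (hilbertSeminorm (ip k)) u₂ *
          ENNReal.ofReal (rcNorm (2 * n + 1) x) * ENNReal.ofReal (rcNorm (2 * n + 1) y)) ∧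
    (∀ (k n : ℕ), 1 ≤ n →
      ∃ φ₁ ∈ nStates (2 * n + 1), ∃ φ₂ ∈ nStates (2 * n + 1),
      ∃ ψ₁ ∈ nStates (2 * n + 1), ∃ ψ₂ ∈ nStates (2 * n + 1),
        ∀ x y : SchwartzOp,
          ‖(ip k).inner (u₂ y) (u₁ x)‖ₑ ≤
            grothendieckK * mapNorm n (hilbertSeminorm (ip k)) u₁ *
              mapNorm n (hilbertSeminorm (ip k)) u₂ *
              ENNReal.ofReal √((φ₁ (star x * x) + φ₂ (x * star x)).re) *
              ENNReal.ofReal √((ψ₁ (star y * y) + ψ₂ (y * star y)).re)) := by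
  have hc : ∀ k, Continuous (hilbertSeminorm (ip k)) := hip.continuous_seminorm
  exact ⟨grothendieckK_le, fun k n m hn x y => enorm_sum_inner_le (hc k) u₁ u₂ hn x y,
    fun k n hn => exists_nStates_enorm_inner_le (hc k) u₁ u₂ hn⟩
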